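/- A \emph{measured weighted graph} $G=(V,w,m)$ consists of a countable set $V$, a symmetric function $w\colon V\times V\to[0,\infty)$ vanishing on the diagonal and a function $m\colon V\to(0,\infty)$. Write $x\sim y$ if $w(x,y)>0$. We assume that $G$ is connected and locally finite (every $x$ has finitely many neighbours $y\sim x$). Put $q(x,y)=w(x,y)/m(x)$, $\operatorname{Deg}_{\max}=\sup_x\sum_y q(x,y)$ and $$\Delta f(x)=\sum_{y}q(x,y)(f(y)-f(x)),\qquad L=-\Delta,\qquad P_t=e^{t\Delta}\quad(t\ge 0),$$ $$\Gamma(f,g)=\tfrac12\big(\Delta(fg)-f\Delta g-g\Delta f\big),\qquad \Gamma_2(f,g)=\tfrac12\big(\Delta\Gamma(f,g)-\Gamma(f,\Delta g)-\Gamma(g,\Delta f)\big).$$ For $\rho\colon V\to\mathbb R$, $G$ satisfies $CD(\rho,\infty)$ if $\Gamma_2(f,f)(x)\ge\rho(x)\,\Gamma(f,f)(x)$ for all bounded $f\colon V\to\mathbb R$ and all $x\in V$. For $T>0$ and $W\colon V\to[0,\infty)$ let $$k_T(W)=\sup_{n\in\mathbb N}\int_0^T\|P_t(n\wedge W)\|_\infty\,dt,$$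 and write $a_-=-\min\{0,a\}$ for $a\in\mathbb R$. Let $\lambda_1$ be the first positive eigenvalue of $L$ in $L^2(V,m)$, and let $$h=\inf\Big\{\frac{|\partial U|}{\operatorname{vol}U}\ :\ \emptyset\ne U\subset V,\ \operatorname{vol}U<\infty,\ \operatorname{vol}U\le\tfrac12\operatorname{vol}V\Big\},\qquad |\partial U|=\sum_{x\in U,\,y\notin U}w(x,y),\quad \operatorname{vol}U=\sum_{x\in U}m(x),$$ be the Cheeger constant (if $\lambda_1$ or $h$ is an infimum over the empty set, as for a single vertex, its value is $+\infty$). \textbf{Theorem (Buser inequality).} Let $K,T>0$, let $G$ be a measured weighted graph with $\operatorname{Deg}_{\max}<\infty$, and let $\rho\colon V\to\mathbb R$ be such that $G$ satisfies $CD(\rho,\infty)$ and $$k_T\big((\rho-K)_-\big)<\tfrac14\big(1-e^{-KT/2}\big).$$ Then there is a constant $c>0$ depending only on $K$, $T$ and $\inf_{x\sim y}\frac{w(x,y)}{m(x)}$ such that $$\lambda_1\le c\,h^2.$$ -/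

import Mathlib

open scoped ENNReal

/-- A measured and weighted graph `(V, w, m)`, locally finite and connected. -/
structure MWG (V : Type*) where
  w : V → V → ℝ
  m : V → ℝ
  w_nonneg : ∀ x y, 0 ≤ w x y
  w_symm : ∀ x y, w x y = w y x
  w_diag : ∀ x, w x x = 0
  m_pos : ∀ x, 0 < m x
  locally_finite : ∀ x, {y | 0 < w x y}.Finite
  connected : ∀ x y, Relation.ReflTransGen (fun a b => 0 < w a b) x y

namespace MWG

noncomputable section

variable {V : Type*} (G : MWG V)

/-- The finite set of neighbours of `x`. -/
def nbr (x : V) : Finset V := (G.locally_finite x).toFinset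

/-- `q(x,y) = w(x,y) / m(x)`. -/
def q (x y : V) : ℝ := G.w x y / G.m x

/-- `Deg(x) = ∑_y q(x,y)`; the terms outside `nbr x` vanish. -/
def deg (x : V) : ℝ := ∑ y ∈ G.nbr x, G.q x y

/-- `Deg_max = sup_x Deg(x)`. -/
def degMax : ℝ≥0∞ := ⨆ x, ENNReal.ofReal (G.deg x)

/-- `inf_{x ∼ y} w(x,y) / m(x)`, over all ordered pairs of neighbours. -/
def qInf : ℝ≥0∞ := ⨅ (x : V) (y : V) (_ : 0 < G.w x y), ENNReal.ofReal (G.q x y)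

/-- The Laplacian `Δ f(x) = ∑_y q(x,y) (f(y) - f(x))`; the terms outside `nbr x` vanish. -/
def lap (f : V → ℝ) (x : V) : ℝ := ∑ y ∈ G.nbr x, G.q x y * (f y - f x)

/-- The carré du champ operator. -/
def Γ (f g : V → ℝ) (x : V) : ℝ :=
  (1 / 2) * (G.lap (fun z => f z * g z) x - f x * G.lap g x - g x * G.lap f x)

/-- The iterated carré du champ operator. -/
def Γ₂ (f g : V → ℝ) (x : V) : ℝ :=
  (1 / 2) * (G.lap (G.Γ f g) x - G.Γ f (G.lap g) x - G.Γ g (G.lap f) x)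

/-- The variable curvature dimension condition `CD(ρ, n)`; for `n = ∞` the term `1/n` is `0`. -/
def CD (ρ : V → ℝ) (n : ℝ≥0∞) : Prop :=
  ∀ f : V → ℝ, (∃ C : ℝ, ∀ x, |f x| ≤ C) →
    ∀ x, ρ x * G.Γ f f x + (n⁻¹).toReal * (G.lap f x) ^ 2 ≤ G.Γ₂ f f x

/-- The heat semigroup `P_t = e^{tΔ}` on bounded functions, through the exponential series. When
`Deg_max < ∞`, the Laplacian is a bounded operator on bounded functions and the series converges
absolutely. -/
def heat (t : ℝ) (f : V → ℝ) (x : V) : ℝ :=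
  ∑' n : ℕ, t ^ n / (n.factorial : ℝ) * (G.lap^[n] f) x

/-- `k_T(W) = sup_n ∫_0^T ‖P_t (n ∧ W)‖_∞ dt`. -/
def kato (T : ℝ) (W : V → ℝ) : ℝ≥0∞ :=
  ⨆ n : ℕ, ∫⁻ t in Set.Ioc 0 T, ⨆ x : V, ‖G.heat t (fun y => min (n : ℝ) (W y)) x‖ₑ

/-- `vol U = ∑_{x ∈ U} m(x)`. -/
def vol (U : Set V) : ℝ≥0∞ := ∑' x : U, ENNReal.ofReal (G.m x)

/-- `|∂U| = ∑_{x ∈ U, y ∉ U} w(x,y)`. -/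
def boundary (U : Set V) : ℝ≥0∞ :=
  ∑' (x : U) (y : (Uᶜ : Set V)), ENNReal.ofReal (G.w x y)

/-- The Cheeger constant: the infimum of `|∂U| / vol U` over nonempty `U` of volume at most half
of the total one. The sets of infinite volume, which do not occur in a finite graph, are left out.
The infimum of the empty set (a graph with one vertex) is `∞`. -/
def cheeger : ℝ≥0∞ :=
  ⨅ (U : Set V) (_ : U.Nonempty ∧ G.vol U ≠ ∞ ∧ G.vol U ≤ G.vol Set.univ / 2),
    G.boundary U / G.vol U

/-- `μ` is an eigenvalue of `L = -Δ` in `L²(V, m)`. -/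
def IsEigenvalue (μ : ℝ) : Prop :=
  ∃ f : V → ℝ, f ≠ 0 ∧ Summable (fun x => G.m x * f x ^ 2) ∧ ∀ x, -G.lap f x = μ * f x

/-- The first positive eigenvalue of `L`; it is `∞` if there is none (a graph with one vertex). -/
def lambda1 : ℝ≥0∞ := ⨅ (μ : ℝ) (_ : 0 < μ ∧ G.IsEigenvalue μ), ENNReal.ofReal μ

end

end MWG

/-!
Put `v = 2 (ρ - K)₋`. By the curvature condition and the comparison principle for the semigroup
generated by `Δ + v`, the functions `e^{2Kt} Γ(P_t f)` and `(P_t f)² + 2t Γ(P_t f)` are dominated by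
this semigroup applied to `Γ(f)` and to `f²` respectively. Smallness of the Kato constant makes the
semigroup bounded on `[0, T]` (Khasminskii's lemma), since `1 + S ∫₀ᵗ P_r v dr` is a supersolution
for a suitable constant `S`. Hence, with `s = e^{-KT/2}`, the operator `P_T` contracts `√Γ` by the
factor `s`, and `P_t` regularizes bounded functions for `t ≤ T`.

Summing the contraction over iterates of `P_T` bounds the oscillation of every bounded `f` with
bounded `Γ(f)`. For truncations of the combinatorial distance this bounds the diameter, so the graph
is finite. The contraction also gives `e^{-λ₁ T} ≤ s`.

On the finite graph, integrating the regularization up to time `t` gives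
`⟨f, f - P_t f⟩ ≤ 2 √t ∑ m √Γ(f)` for `|f| ≤ 1`, while the spectral gap gives
`⟨f, f - P_t f⟩ ≥ (1 - e^{-λ₁ t}) Var f`. For the indicator of `U` one has `Var ≥ vol U / 2`, and
`√Γ ≤ √(2 / q₀) Γ` because a nonzero `Γ` is at least `q₀ / 2`; the choice `t = -log s / λ₁ ≤ T`
then yields Buser's inequality.
-/

section BuserInequality

open NormedSpace
open scoped BoundedContinuousFunction

set_option maxSynthPendingDepth 4

section Exponential

variable {E : Type*} [NormedAddCommGroup E] [NormedSpace ℝ E] [CompleteSpace E]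

theorem hasSum_exp_apply (A : E →L[ℝ] E) (x : E) :
    HasSum (fun n : ℕ => (n.factorial : ℝ)⁻¹ • (A ^ n) x) (exp A x) :=
  (exp_series_hasSum_exp' (𝕂 := ℝ) A).mapL (ContinuousLinearMap.apply ℝ E x)

theorem exp_apply_of_apply_eq_smul {A : E →L[ℝ] E} {c : ℝ} {x : E} (h : A x = c • x) :
    exp A x = Real.exp c • x := by
  have hpow (n : ℕ) : (A ^ n) x = c ^ n • x := by
    induction n with
    | zero => simp
    | succ n ih => rw [pow_succ, mul_apply_eq_comp, h, map_smul, ih, smul_smul, ← pow_succ']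
  have hexp : HasSum (fun n : ℕ => (n.factorial : ℝ)⁻¹ • c ^ n) (Real.exp c) := by
    rw [Real.exp_eq_exp_ℝ]
    exact exp_series_hasSum_exp' (𝕂 := ℝ) c
  refine (hasSum_exp_apply A x).unique ?_
  simpa only [hpow, smul_assoc] using hexp.smul_const x

theorem exp_add_smul_one (A : E →L[ℝ] E) (c : ℝ) :
    exp (A + c • (1 : E →L[ℝ] E)) = Real.exp c • exp A := by
  let _ : NormedAlgebra ℚ (E →L[ℝ] E) := NormedAlgebra.restrictScalars ℚ ℝ _
  rw [exp_add_of_commute ((Commute.one_right A).smul_right c), ← Algebra.algebraMap_eq_smul_one,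
    ← algebraMap_exp_comm, Algebra.algebraMap_eq_smul_one, mul_smul_comm, mul_one,
    Real.exp_eq_exp_ℝ]

theorem hasDerivAt_exp_smul_apply (A : E →L[ℝ] E) (x : E) (t : ℝ) :
    HasDerivAt (fun t : ℝ => exp (t • A) x) (A (exp (t • A) x)) t := by
  simpa using (hasDerivAt_exp_smul_const' (𝕂 := ℝ) A t).clm_apply (hasDerivAt_const t x)

theorem continuous_exp_smul_apply (A : E →L[ℝ] E) (x : E) :
    Continuous fun t : ℝ => exp (t • A) x :=
  continuous_iff_continuousAt.2 fun t => (hasDerivAt_exp_smul_apply A x t).continuousAt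

theorem hasDerivAt_integral_exp_smul_apply (A : E →L[ℝ] E) (x : E) (t : ℝ) :
    HasDerivAt (fun t : ℝ => ∫ r in (0 : ℝ)..t, exp (r • A) x) (exp (t • A) x) t :=
  ((continuous_exp_smul_apply A x).integral_hasStrictDerivAt 0 t).hasDerivAt

theorem apply_integral_exp_smul_apply (A : E →L[ℝ] E) (x : E) (t : ℝ) :
    A (∫ r in (0 : ℝ)..t, exp (r • A) x) = exp (t • A) x - x := by
  have hcont := continuous_exp_smul_apply A x
  have hint : IntervalIntegrable (fun r : ℝ => exp (r • A) x) MeasureTheory.volume 0 t :=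
    hcont.intervalIntegrable 0 t
  rw [← A.intervalIntegral_comp_comm hint, intervalIntegral.integral_eq_sub_of_hasDerivAt
    (fun r _ => hasDerivAt_exp_smul_apply A x r) ((A.continuous.comp hcont).intervalIntegrable 0 t)]
  simp

theorem hasDerivAt_exp_sub_smul_apply (A : E →L[ℝ] E) {u : ℝ → E} {u' : E} {s : ℝ}
    (hu : HasDerivAt u u' s) (t : ℝ) :
    HasDerivAt (fun s : ℝ => exp ((t - s) • A) (u s)) (exp ((t - s) • A) (u' - A (u s))) s := by
  have h := ((hasDerivAt_exp_smul_const (𝕂 := ℝ) A (t - s)).scomp s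
    ((hasDerivAt_id s).const_sub t)).clm_apply hu
  refine h.congr_deriv ?_
  simp [sub_eq_neg_add]

end Exponential

theorem hasDerivAt_apply {X : Type*} [TopologicalSpace X] {u : ℝ → X →ᵇ ℝ} {u' : X →ᵇ ℝ} {t : ℝ}
    (hu : HasDerivAt u u' t) (x : X) : HasDerivAt (fun t => u t x) (u' x) t := by
  have h := (BoundedContinuousFunction.evalCLM ℝ x).hasFDerivAt.comp_hasDerivAt t hu
  exact h

/-- An operator on bounded functions is quasi-positive if it becomes positive after the addition of
a large multiple of the identity. These are the bounded generators of positive semigroups. -/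
def QuasiPositive {X : Type*} [TopologicalSpace X] (A : (X →ᵇ ℝ) →L[ℝ] (X →ᵇ ℝ)) : Prop :=
  ∃ c : ℝ, ∀ f, 0 ≤ f → 0 ≤ A f + c • f

namespace QuasiPositive

variable {X : Type*} [TopologicalSpace X] {A : (X →ᵇ ℝ) →L[ℝ] (X →ᵇ ℝ)}

theorem smul (hA : QuasiPositive A) {t : ℝ} (ht : 0 ≤ t) : QuasiPositive (t • A) := by
  obtain ⟨c, hc⟩ := hA
  refine ⟨t * c, fun f hf x => ?_⟩
  have h : 0 ≤ t * (A f x + c * f x) := mul_nonneg ht (hc f hf x)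
  simpa [mul_add, mul_assoc] using h

theorem add_mul (hA : QuasiPositive A) (v : X →ᵇ ℝ) :
    QuasiPositive (A + ContinuousLinearMap.mul ℝ (X →ᵇ ℝ) v) := by
  obtain ⟨c, hc⟩ := hA
  refine ⟨c + ‖v‖, fun f hf x => ?_⟩
  have hv : 0 ≤ (v x + ‖v‖) * f x :=
    mul_nonneg (by linarith [(abs_le.1 (v.norm_coe_le_norm x)).1]) (hf x)
  have hAf : 0 ≤ A f x + c * f x := hc f hf x
  change 0 ≤ A f x + v x * f x + (c + ‖v‖) * f x
  linarith

theorem exp_nonneg (hA : QuasiPositive A) {f : X →ᵇ ℝ} (hf : 0 ≤ f) : 0 ≤ exp A f := by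
  obtain ⟨c, hc⟩ := hA
  have hpow (n : ℕ) : 0 ≤ ((A + c • (1 : (X →ᵇ ℝ) →L[ℝ] (X →ᵇ ℝ))) ^ n) f := by
    induction n with
    | zero => exact hf
    | succ n ih => rw [pow_succ']; exact hc _ ih
  intro x
  have hsum := (hasSum_exp_apply (A + c • 1) f).mapL (BoundedContinuousFunction.evalCLM ℝ x)
  have h : 0 ≤ Real.exp c * exp A f x := by
    rw [exp_add_smul_one] at hsum
    exact hsum.nonneg fun n => mul_nonneg (by positivity) (hpow n x)
  exact nonneg_of_mul_nonneg_right h (Real.exp_pos c)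

theorem exp_mono (hA : QuasiPositive A) {f g : X →ᵇ ℝ} (hfg : f ≤ g) : exp A f ≤ exp A g := by
  simpa only [map_sub, sub_nonneg] using hA.exp_nonneg (sub_nonneg.2 hfg)

theorem le_exp_smul_of_hasDerivAt_le (hA : QuasiPositive A) {u u' : ℝ → X →ᵇ ℝ} {t : ℝ}
    (ht : 0 ≤ t) (hu : ∀ s, HasDerivAt u (u' s) s) (hle : ∀ s ∈ Set.Ioo 0 t, u' s ≤ A (u s)) :
    u t ≤ exp (t • A) (u 0) := by
  intro x
  have hder (s : ℝ) : HasDerivAt (fun s => exp ((t - s) • A) (u s) x)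
      (exp ((t - s) • A) (u' s - A (u s)) x) s :=
    hasDerivAt_apply (hasDerivAt_exp_sub_smul_apply A (hu s) t) x
  have hanti : AntitoneOn (fun s => exp ((t - s) • A) (u s) x) (Set.Icc 0 t) := by
    refine antitoneOn_of_deriv_nonpos (convex_Icc 0 t)
      (fun s _ => (hder s).continuousAt.continuousWithinAt)
      (fun s _ => (hder s).differentiableAt.differentiableWithinAt) fun s hs => ?_
    rw [interior_Icc] at hs
    rw [(hder s).deriv]
    have h := (hA.smul (sub_nonneg.2 hs.2.le)).exp_mono (sub_nonpos.2 (hle s hs))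
    rw [map_zero] at h
    exact h x
  simpa using hanti ⟨le_rfl, ht⟩ ⟨ht, le_rfl⟩ ht

theorem exp_smul_add_mul_one_le (hA : QuasiPositive A) (hA1 : A 1 = 0) {v : X →ᵇ ℝ} (hv : 0 ≤ v)
    {t k : ℝ} (ht : 0 ≤ t) (hk : k < 1)
    (hvk : ∀ s ∈ Set.Icc 0 t, ∀ x, ∫ r in (0 : ℝ)..s, exp (r • A) v x ≤ k) (x : X) :
    exp (t • (A + ContinuousLinearMap.mul ℝ (X →ᵇ ℝ) v)) 1 x ≤ 1 / (1 - k) := by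
  set S : ℝ := 1 / (1 - k) with hS
  have hS0 : 0 < S := one_div_pos.2 (sub_pos.2 hk)
  have hSk : 1 + S * k = S := by rw [hS]; field_simp [(sub_pos.2 hk).ne']; ring
  set I : ℝ → X →ᵇ ℝ := fun s => ∫ r in (0 : ℝ)..s, exp (r • A) v with hI
  have hI0 : I 0 = 0 := intervalIntegral.integral_same
  have hI_le {s : ℝ} (hs : s ∈ Set.Icc 0 t) (y : X) : I s y ≤ k := by
    have hint : IntervalIntegrable (fun r : ℝ => exp (r • A) v) MeasureTheory.volume 0 s :=
      (continuous_exp_smul_apply A v).intervalIntegrable 0 s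
    exact ((BoundedContinuousFunction.evalCLM ℝ y).intervalIntegral_comp_comm hint).symm.trans_le
      (hvk s hs y)
  have hz {s : ℝ} (hs : s ∈ Set.Icc 0 t) (y : X) : 1 + S * I s y ≤ S := by
    nlinarith [hI_le hs y]
  -- `1 + S • I s` is a supersolution of `u' = (A + v) u`, because it stays below `S`.
  have hcomp := (hA.add_mul v).le_exp_smul_of_hasDerivAt_le ht (u := fun s => -(1 + S • I s))
    (fun s => (((hasDerivAt_integral_exp_smul_apply A v s).const_smul S).const_add 1).neg)
    fun s hs y => by
      have hAI : A (I s) y = exp (s • A) v y - v y := by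
        rw [hI, apply_integral_exp_smul_apply]; rfl
      have h := mul_le_mul_of_nonneg_left (hz ⟨hs.1.le, hs.2.le⟩ y) (hv y)
      rw [map_neg, add_apply, map_add, hA1, zero_add, map_smul]
      change -(S * exp (s • A) v y) ≤ -(S * A (I s) y + v y * (1 + S * I s y))
      rw [hAI]
      change v y * (1 + S * I s y) ≤ v y * S at h
      linarith
  have hx := hcomp x
  simp only [hI0, smul_zero, add_zero, map_neg] at hx
  exact (neg_le_neg_iff.1 hx).trans (hz ⟨ht, le_rfl⟩ x)

end QuasiPositive

namespace MWG

section CarreDuChamp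

variable {V : Type*} (G : MWG V)

theorem mem_nbr {x y : V} : y ∈ G.nbr x ↔ 0 < G.w x y := by simp [nbr]

theorem q_nonneg (x y : V) : 0 ≤ G.q x y := div_nonneg (G.w_nonneg x y) (G.m_pos x).le

theorem q_pos {x y : V} (h : 0 < G.w x y) : 0 < G.q x y := div_pos h (G.m_pos x)

theorem deg_le_toReal_degMax (h : G.degMax < ∞) (x : V) : G.deg x ≤ G.degMax.toReal :=
  (ENNReal.ofReal_le_iff_le_toReal h.ne).1 (le_iSup (fun x => ENNReal.ofReal (G.deg x)) x)

theorem Γ_eq_sum (f g : V → ℝ) (x : V) :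
    G.Γ f g x = 1 / 2 * ∑ y ∈ G.nbr x, G.q x y * ((f y - f x) * (g y - g x)) := by
  simp only [Γ, lap, Finset.mul_sum, ← Finset.sum_sub_distrib]
  exact Finset.sum_congr rfl fun y _ => by ring

theorem Γ_self_nonneg (f : V → ℝ) (x : V) : 0 ≤ G.Γ f f x := by
  rw [Γ_eq_sum]
  exact mul_nonneg (by norm_num)
    (Finset.sum_nonneg fun y _ => mul_nonneg (G.q_nonneg x y) (mul_self_nonneg _))

theorem q_mul_sq_le_two_mul_Γ (f : V → ℝ) {x y : V} (hxy : 0 < G.w x y) :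
    G.q x y * (f y - f x) ^ 2 ≤ 2 * G.Γ f f x := by
  have hs := Finset.single_le_sum (f := fun y => G.q x y * ((f y - f x) * (f y - f x)))
    (fun y _ => mul_nonneg (G.q_nonneg x y) (mul_self_nonneg _)) (G.mem_nbr.2 hxy)
  rw [Γ_eq_sum]
  linarith [sq (f y - f x)]

theorem eq_of_Γ_eq_zero {f : V → ℝ} (hf : ∀ x, G.Γ f f x = 0) (x y : V) : f y = f x := by
  induction G.connected x y with
  | refl => rfl
  | @tail a b _ hab ih =>
    have hsq : (f b - f a) ^ 2 ≤ 0 := by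
      refine nonpos_of_mul_nonpos_right ?_ (G.q_pos hab)
      simpa [hf a] using G.q_mul_sq_le_two_mul_Γ f hab
    rw [← ih]
    exact sub_eq_zero.1 (pow_eq_zero_iff two_ne_zero |>.1 (hsq.antisymm (sq_nonneg _)))

theorem Γ_const_mul (c : ℝ) (f : V → ℝ) (x : V) :
    G.Γ (fun y => c * f y) (fun y => c * f y) x = c ^ 2 * G.Γ f f x := by
  simp only [Γ_eq_sum, Finset.mul_sum]
  exact Finset.sum_congr rfl fun y _ => by ring

theorem lap_eq_zero_of_Γ_eq_zero {f : V → ℝ} (hf : ∀ x, G.Γ f f x = 0) (x : V) :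
    G.lap f x = 0 :=
  Finset.sum_eq_zero fun y _ => by rw [G.eq_of_Γ_eq_zero hf x y, sub_self, mul_zero]

theorem Γ_sq_le (f g : V → ℝ) (x : V) : G.Γ f g x ^ 2 ≤ G.Γ f f x * G.Γ g g x := by
  have h := Finset.sum_sq_le_sum_mul_sum_of_sq_le_mul (G.nbr x)
    (r := fun y => G.q x y * ((f y - f x) * (g y - g x)))
    (f := fun y => G.q x y * ((f y - f x) * (f y - f x)))
    (g := fun y => G.q x y * ((g y - g x) * (g y - g x)))
    (fun y _ => mul_nonneg (G.q_nonneg x y) (mul_self_nonneg _))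
    (fun y _ => mul_nonneg (G.q_nonneg x y) (mul_self_nonneg _)) fun y _ => le_of_eq (by ring)
  simp only [Γ_eq_sum]
  linarith

theorem lap_sq_le (f : V → ℝ) (x : V) : G.lap f x ^ 2 ≤ 2 * G.deg x * G.Γ f f x := by
  have h := Finset.sum_sq_le_sum_mul_sum_of_sq_le_mul (G.nbr x)
    (r := fun y => G.q x y * (f y - f x)) (f := fun y => G.q x y)
    (g := fun y => G.q x y * ((f y - f x) * (f y - f x)))
    (fun y _ => G.q_nonneg x y)
    (fun y _ => mul_nonneg (G.q_nonneg x y) (mul_self_nonneg _)) fun y _ => le_of_eq (by ring)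
  rw [Γ_eq_sum, lap, deg]
  linarith

theorem lap_sq_le_degMax (h : G.degMax < ∞) (f : V → ℝ) (x : V) :
    G.lap f x ^ 2 ≤ 2 * G.degMax.toReal * G.Γ f f x := by
  have := mul_le_mul_of_nonneg_right (G.deg_le_toReal_degMax h x) (G.Γ_self_nonneg f x)
  linarith [G.lap_sq_le f x]

theorem lap_eq_sum_sub (f : V → ℝ) (x : V) :
    G.lap f x = ∑ y ∈ G.nbr x, G.q x y * f y - G.deg x * f x := by
  simp only [lap, deg, mul_sub, Finset.sum_sub_distrib, Finset.sum_mul]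

theorem abs_lap_le (h : G.degMax < ∞) {C : ℝ} {f : V → ℝ} (hf : ∀ x, |f x| ≤ C) (x : V) :
    |G.lap f x| ≤ 2 * G.degMax.toReal * C := by
  have hC : 0 ≤ C := (abs_nonneg _).trans (hf x)
  calc |G.lap f x| ≤ ∑ y ∈ G.nbr x, |G.q x y * (f y - f x)| := Finset.abs_sum_le_sum_abs _ _
    _ ≤ ∑ y ∈ G.nbr x, G.q x y * (2 * C) := by
        refine Finset.sum_le_sum fun y _ => ?_
        rw [abs_mul, abs_of_nonneg (G.q_nonneg x y)]
        exact mul_le_mul_of_nonneg_left (by linarith [abs_sub (f y) (f x), hf y, hf x])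
          (G.q_nonneg x y)
    _ = G.deg x * (2 * C) := by rw [deg, Finset.sum_mul]
    _ ≤ G.degMax.toReal * (2 * C) := by gcongr; exact G.deg_le_toReal_degMax h x
    _ = 2 * G.degMax.toReal * C := by ring

end CarreDuChamp

section Curvature

variable {V : Type*} {G : MWG V}

theorem two_mul_Γ₂_self (f : V → ℝ) (x : V) :
    2 * G.Γ₂ f f x = G.lap (G.Γ f f) x - 2 * G.Γ f (G.lap f) x := by
  unfold Γ₂; ring

theorem two_mul_Γ₂_self_eq_sum (f : V → ℝ) (x : V) :
    2 * G.Γ₂ f f x = G.lap f x ^ 2 - G.deg x * G.Γ f f x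
      + ∑ y ∈ G.nbr x, G.q x y * (G.Γ f f y - (f y - f x) * G.lap f y) := by
  have hsq : G.lap f x ^ 2 = ∑ y ∈ G.nbr x, G.q x y * (f y - f x) * G.lap f x :=
    (sq _).trans (Finset.sum_mul ..)
  have hΓ : 2 * G.Γ f (G.lap f) x
      = ∑ y ∈ G.nbr x, G.q x y * ((f y - f x) * G.lap f y) - G.lap f x ^ 2 := by
    rw [Γ_eq_sum, hsq, ← Finset.sum_sub_distrib, ← mul_assoc, Finset.mul_sum]
    exact Finset.sum_congr rfl fun y _ => by ring
  rw [two_mul_Γ₂_self, lap_eq_sum_sub, hΓ]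
  simp only [mul_sub, Finset.sum_sub_distrib]
  ring

theorem neg_degMax_mul_Γ_le_Γ₂ (h : G.degMax < ∞) (f : V → ℝ) (x : V) :
    -G.degMax.toReal * G.Γ f f x ≤ G.Γ₂ f f x := by
  set D := G.degMax.toReal
  have : 0 ≤ D := ENNReal.toReal_nonneg
  -- AM-GM, with `(Δf)² ≤ 2DΓ(f)`
  have hpt (y : V) : (f y - f x) * G.lap f y ≤ D / 2 * (f y - f x) ^ 2 + G.Γ f f y := by
    refine le_of_abs_le (abs_le_of_sq_le_sq ?_ ?_)
    · have := mul_le_mul_of_nonneg_left (G.lap_sq_le_degMax h f y) (sq_nonneg (f y - f x))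
      nlinarith [sq_nonneg (D / 2 * (f y - f x) ^ 2 - G.Γ f f y)]
    · have := G.Γ_self_nonneg f y
      positivity
  have hsum : -(D * G.Γ f f x)
      ≤ ∑ y ∈ G.nbr x, G.q x y * (G.Γ f f y - (f y - f x) * G.lap f y) := by
    rw [Γ_eq_sum, ← mul_assoc, Finset.mul_sum, ← Finset.sum_neg_distrib]
    refine Finset.sum_le_sum fun y _ => ?_
    linarith [mul_le_mul_of_nonneg_left (hpt y) (G.q_nonneg x y)]
  have hdeg := mul_le_mul_of_nonneg_right (G.deg_le_toReal_degMax h x) (G.Γ_self_nonneg f x)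
  linarith [two_mul_Γ₂_self_eq_sum (G := G) f x, sq_nonneg (G.lap f x)]

theorem CD_top_iff {ρ : V → ℝ} : G.CD ρ ∞ ↔
    ∀ f : V → ℝ, (∃ C : ℝ, ∀ x, |f x| ≤ C) → ∀ x, ρ x * G.Γ f f x ≤ G.Γ₂ f f x := by
  simp [CD]

theorem CD.two_mul_mul_Γ_le {ρ : V → ℝ} (hρ : G.CD ρ ∞) {f : V → ℝ}
    (hf : ∃ C : ℝ, ∀ x, |f x| ≤ C) (x : V) :
    2 * (ρ x * G.Γ f f x) ≤ G.lap (G.Γ f f) x - 2 * G.Γ f (G.lap f) x := by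
  linarith [CD_top_iff.1 hρ f hf x, two_mul_Γ₂_self (G := G) f x]

theorem CD.mono {ρ ρ' : V → ℝ} (hρ : G.CD ρ ∞) (hle : ρ' ≤ ρ) : G.CD ρ' ∞ :=
  CD_top_iff.2 fun f hf x =>
    (mul_le_mul_of_nonneg_right (hle x) (G.Γ_self_nonneg f x)).trans (CD_top_iff.1 hρ f hf x)

theorem CD.max_neg_degMax {ρ : V → ℝ} (hρ : G.CD ρ ∞) (h : G.degMax < ∞) :
    G.CD (fun x => max (ρ x) (-G.degMax.toReal)) ∞ := by
  refine CD_top_iff.2 fun f hf x => ?_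
  rcases max_choice (ρ x) (-G.degMax.toReal) with hx | hx
  · simpa only [hx] using CD_top_iff.1 hρ f hf x
  · simpa only [hx] using neg_degMax_mul_Γ_le_Γ₂ h f x

theorem CD.sub_min {ρ : V → ℝ} {K n : ℝ} (hρ : G.CD ρ ∞) (h : G.degMax < ∞)
    (hn : K + G.degMax.toReal ≤ n) : G.CD (fun x => K - min n (-min 0 (ρ x - K))) ∞ := by
  refine (hρ.max_neg_degMax h).mono fun x => ?_
  rw [sub_le_iff_le_add]
  rcases min_choice n (-min 0 (ρ x - K)) with hx | hx <;> rw [hx]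
  · linarith [le_max_right (ρ x) (-G.degMax.toReal)]
  · linarith [le_max_left (ρ x) (-G.degMax.toReal), min_le_right 0 (ρ x - K)]

end Curvature

section HeatSemigroup

variable {V : Type*} {G : MWG V} [TopologicalSpace V] [DiscreteTopology V] (h : G.degMax < ∞)

/-- The Laplacian as a bounded operator on bounded functions. The vertex set carries the discrete
topology, so that `V →ᵇ ℝ` consists of all bounded functions. -/
noncomputable def lapCLM : (V →ᵇ ℝ) →L[ℝ] (V →ᵇ ℝ) :=
  LinearMap.mkContinuous
    { toFun := fun f => BoundedContinuousFunction.ofNormedAddCommGroupDiscrete (G.lap f)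
        (2 * G.degMax.toReal * ‖f‖) (G.abs_lap_le h f.norm_coe_le_norm)
      map_add' := fun f g => by
        ext x
        simp only [BoundedContinuousFunction.coe_ofNormedAddCommGroupDiscrete,
          BoundedContinuousFunction.coe_add, Pi.add_apply, lap, ← Finset.sum_add_distrib]
        exact Finset.sum_congr rfl fun y _ => by ring
      map_smul' := fun c f => by
        ext x
        simp only [BoundedContinuousFunction.coe_ofNormedAddCommGroupDiscrete,
          BoundedContinuousFunction.coe_smul, smul_eq_mul, lap, Finset.mul_sum, RingHom.id_apply]
        exact Finset.sum_congr rfl fun y _ => by ring }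
    (2 * G.degMax.toReal)
    fun f => (BoundedContinuousFunction.norm_le (by positivity)).2
      (G.abs_lap_le h f.norm_coe_le_norm)

theorem lapCLM_apply (f : V →ᵇ ℝ) (x : V) : lapCLM h f x = G.lap f x := rfl

theorem lapCLM_one : lapCLM h 1 = 0 := by
  ext x
  simp [lapCLM_apply, lap]

theorem quasiPositive_lapCLM : QuasiPositive (lapCLM h) := by
  refine ⟨G.degMax.toReal, fun f hf x => ?_⟩
  have hdeg := mul_le_mul_of_nonneg_right (G.deg_le_toReal_degMax h x) (hf x)
  have hsum : 0 ≤ ∑ y ∈ G.nbr x, G.q x y * f y :=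
    Finset.sum_nonneg fun y _ => mul_nonneg (G.q_nonneg x y) (hf y)
  change 0 ≤ G.lap f x + G.degMax.toReal * f x
  rw [lap_eq_sum_sub]
  change G.deg x * f x ≤ G.degMax.toReal * f x at hdeg
  linarith

/-- The heat semigroup `P_t` as a bounded operator on bounded functions. -/
noncomputable def heatCLM (t : ℝ) : (V →ᵇ ℝ) →L[ℝ] (V →ᵇ ℝ) := exp (t • lapCLM h)

theorem heat_eq_heatCLM (t : ℝ) (f : V →ᵇ ℝ) (x : V) : G.heat t f x = heatCLM h t f x := by
  have hpow (n : ℕ) : (⇑((lapCLM h ^ n) f) : V → ℝ) = G.lap^[n] f := by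
    induction n with
    | zero => rfl
    | succ n ih => rw [pow_succ', Function.iterate_succ_apply', ← ih]; rfl
  have hsum := (hasSum_exp_apply (t • lapCLM h) f).mapL (BoundedContinuousFunction.evalCLM ℝ x)
  refine (tsum_congr fun n => ?_).trans hsum.tsum_eq
  rw [smul_pow, ← hpow]
  change t ^ n / n.factorial * (lapCLM h ^ n) f x
    = (n.factorial : ℝ)⁻¹ * (t ^ n * (lapCLM h ^ n) f x)
  ring

theorem heatCLM_zero (f : V →ᵇ ℝ) : heatCLM h 0 f = f := by simp [heatCLM]

theorem hasDerivAt_heatCLM (f : V →ᵇ ℝ) (t : ℝ) :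
    HasDerivAt (fun t => heatCLM h t f) (lapCLM h (heatCLM h t f)) t :=
  hasDerivAt_exp_smul_apply (lapCLM h) f t

/-- The Feynman–Kac semigroup generated by the Schrödinger operator `Δ + v`. -/
noncomputable def feynmanKac (v : V →ᵇ ℝ) (t : ℝ) : (V →ᵇ ℝ) →L[ℝ] (V →ᵇ ℝ) :=
  exp (t • (lapCLM h + ContinuousLinearMap.mul ℝ (V →ᵇ ℝ) v))

theorem feynmanKac_apply_le {v f : V →ᵇ ℝ} {t M C : ℝ} (ht : 0 ≤ t) (hC : 0 ≤ C)
    (hM : ∀ x, feynmanKac h v t 1 x ≤ M) (hf : ∀ x, f x ≤ C) (x : V) :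
    feynmanKac h v t f x ≤ C * M := by
  have hle : f ≤ C • (1 : V →ᵇ ℝ) := fun y => by simpa using hf y
  refine ((((quasiPositive_lapCLM h).add_mul v).smul ht).exp_mono hle x).trans ?_
  rw [map_smul]
  exact mul_le_mul_of_nonneg_left (hM x) hC

/-- The carré du champ of bounded functions as a bounded function. -/
noncomputable def ΓB (f g : V →ᵇ ℝ) : V →ᵇ ℝ :=
  (1 / 2 : ℝ) • (lapCLM h (f * g) - f * lapCLM h g - g * lapCLM h f)

theorem ΓB_apply (f g : V →ᵇ ℝ) (x : V) : ΓB h f g x = G.Γ f g x := rfl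

theorem hasDerivAt_ΓB_heatCLM (f : V →ᵇ ℝ) (t : ℝ) :
    HasDerivAt (fun t => ΓB h (heatCLM h t f) (heatCLM h t f))
      ((2 : ℝ) • ΓB h (heatCLM h t f) (lapCLM h (heatCLM h t f))) t := by
  have hP := hasDerivAt_heatCLM h f t
  have hΔ := (lapCLM h).hasFDerivAt.comp_hasDerivAt t hP
  have hΓ := (((lapCLM h).hasFDerivAt.comp_hasDerivAt t (hP.mul hP)).sub
    (hP.mul hΔ) |>.sub (hP.mul hΔ)).const_smul (1 / 2 : ℝ)
  refine hΓ.congr_deriv ?_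
  simp only [ΓB, Function.comp_apply, map_add, mul_comm (lapCLM h (heatCLM h t f))]
  module

theorem exp_mul_Γ_heatCLM_le {K : ℝ} {U : V →ᵇ ℝ} (hCD : G.CD (fun x => K - U x) ∞) {t : ℝ}
    (ht : 0 ≤ t) (f : V →ᵇ ℝ) (x : V) :
    Real.exp (2 * K * t) * G.Γ (heatCLM h t f) (heatCLM h t f) x
      ≤ feynmanKac h ((2 : ℝ) • U) t (ΓB h f f) x := by
  have hexp (s : ℝ) :
      HasDerivAt (fun s => Real.exp (2 * K * s)) (Real.exp (2 * K * s) * (2 * K)) s := by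
    simpa using ((hasDerivAt_id s).const_mul (2 * K)).exp
  have hcomp := ((quasiPositive_lapCLM h).add_mul ((2 : ℝ) • U)).le_exp_smul_of_hasDerivAt_le ht
    (u := fun s => Real.exp (2 * K * s) • ΓB h (heatCLM h s f) (heatCLM h s f))
    (fun s => (hexp s).smul (hasDerivAt_ΓB_heatCLM h f s)) fun s _ y => by
      set g := heatCLM h s f
      have hbochner := mul_le_mul_of_nonneg_left
        (hCD.two_mul_mul_Γ_le ⟨‖g‖, g.norm_coe_le_norm⟩ y) (Real.exp_pos (2 * K * s)).le
      simp only [map_smul]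
      change Real.exp (2 * K * s) * (2 * G.Γ g (G.lap g) y)
          + Real.exp (2 * K * s) * (2 * K) * G.Γ g g y
        ≤ Real.exp (2 * K * s) * (G.lap (G.Γ g g) y + 2 * (U y * G.Γ g g y))
      linarith
  simpa [heatCLM_zero, feynmanKac, ΓB_apply] using hcomp x

theorem sq_add_mul_Γ_heatCLM_le {U : V →ᵇ ℝ} (hU : 0 ≤ U) (hCD : G.CD (fun x => -U x) ∞) {t : ℝ}
    (ht : 0 ≤ t) (f : V →ᵇ ℝ) (x : V) :
    heatCLM h t f x ^ 2 + 2 * t * G.Γ (heatCLM h t f) (heatCLM h t f) x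
      ≤ feynmanKac h ((2 : ℝ) • U) t (f ^ 2) x := by
  have hP := hasDerivAt_heatCLM h f
  have hcomp := ((quasiPositive_lapCLM h).add_mul ((2 : ℝ) • U)).le_exp_smul_of_hasDerivAt_le ht
    (u := fun s => heatCLM h s f * heatCLM h s f
      + (2 * s) • ΓB h (heatCLM h s f) (heatCLM h s f))
    (fun s => ((hP s).mul (hP s)).add
      (((hasDerivAt_id s).const_mul 2).smul (hasDerivAt_ΓB_heatCLM h f s))) fun s hs y => by
      set g := heatCLM h s f
      have hbochner := mul_le_mul_of_nonneg_left
        (hCD.two_mul_mul_Γ_le ⟨‖g‖, g.norm_coe_le_norm⟩ y) hs.1.le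
      have hUg : 0 ≤ U y * g y ^ 2 := mul_nonneg (hU y) (sq_nonneg _)
      have hΓ : G.Γ g g y = 1 / 2 * (G.lap (fun z => g z * g z) y - g y * G.lap g y
        - g y * G.lap g y) := rfl
      simp only [map_add, map_smul]
      change (G.lap g y * g y + g y * G.lap g y)
          + (2 * s * (2 * G.Γ g (G.lap g) y) + 2 * 1 * G.Γ g g y)
        ≤ (G.lap (fun z => g z * g z) y + 2 * (U y * (g y * g y)))
          + 2 * s * (G.lap (G.Γ g g) y + 2 * (U y * G.Γ g g y))
      linarith
  simpa [heatCLM_zero, feynmanKac, ΓB_apply, sq] using hcomp x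

theorem Γ_heatCLM_le {K M C t : ℝ} {U : V →ᵇ ℝ} (hCD : G.CD (fun x => K - U x) ∞) (ht : 0 ≤ t)
    (hM : ∀ x, feynmanKac h ((2 : ℝ) • U) t 1 x ≤ M) {f : V →ᵇ ℝ} (hf : ∀ x, G.Γ f f x ≤ C)
    (x : V) : G.Γ (heatCLM h t f) (heatCLM h t f) x ≤ Real.exp (-(2 * K * t)) * M * C := by
  have hC : 0 ≤ C := (G.Γ_self_nonneg f x).trans (hf x)
  have hexp := (exp_mul_Γ_heatCLM_le h hCD ht f x).trans (feynmanKac_apply_le h ht hC hM hf x)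
  rw [Real.exp_neg, mul_assoc, mul_comm M C]
  exact (le_inv_mul_iff₀ (Real.exp_pos _)).2 hexp

theorem two_mul_mul_Γ_heatCLM_le {M t : ℝ} {U : V →ᵇ ℝ} (hU : 0 ≤ U)
    (hCD : G.CD (fun x => -U x) ∞) (ht : 0 ≤ t)
    (hM : ∀ x, feynmanKac h ((2 : ℝ) • U) t 1 x ≤ M) {f : V →ᵇ ℝ} (hf : ∀ x, |f x| ≤ 1) (x : V) :
    2 * t * G.Γ (heatCLM h t f) (heatCLM h t f) x ≤ M := by
  have hf2 : ∀ y, (f ^ 2) y ≤ 1 := fun y => (sq_le_one_iff_abs_le_one (f y)).2 (hf y)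
  have hsq := (sq_add_mul_Γ_heatCLM_le h hU hCD ht f x).trans
    (feynmanKac_apply_le h ht zero_le_one hM hf2 x)
  linarith [sq_nonneg (heatCLM h t f x)]

theorem integral_heatCLM_le_kato {T : ℝ} {n : ℕ} {W : V → ℝ} {U : V →ᵇ ℝ}
    (hUW : ∀ x, U x = min (n : ℝ) (W x)) (hU : 0 ≤ U) (hk : G.kato T W ≠ ∞) {t : ℝ}
    (ht : t ∈ Set.Icc 0 T) (x : V) :
    ∫ r in (0 : ℝ)..t, heatCLM h r U x ≤ (G.kato T W).toReal := by
  have hcont : Continuous fun r => heatCLM h r U x := continuous_iff_continuousAt.2 fun r =>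
    (hasDerivAt_apply (hasDerivAt_heatCLM h U r) x).continuousAt
  have hnonneg : ∀ r ∈ Set.Ioc 0 t, 0 ≤ heatCLM h r U x := fun r hr =>
    ((quasiPositive_lapCLM h).smul hr.1.le).exp_nonneg hU x
  rw [← ENNReal.ofReal_le_iff_le_toReal hk, intervalIntegral.integral_of_le ht.1,
    MeasureTheory.ofReal_integral_eq_lintegral_ofReal
      (hcont.integrableOn_Icc.mono_set Set.Ioc_subset_Icc_self)
      ((MeasureTheory.ae_restrict_iff' measurableSet_Ioc).2 (Filter.Eventually.of_forall hnonneg))]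
  refine le_trans ?_ (le_iSup _ n)
  refine (MeasureTheory.lintegral_mono_set (Set.Ioc_subset_Ioc_right ht.2)).trans ?_
  refine MeasureTheory.lintegral_mono fun r => le_trans ?_ (le_iSup _ x)
  rw [← funext hUW, heat_eq_heatCLM h]
  exact Real.ofReal_le_enorm _

theorem feynmanKac_one_le_of_kato {T : ℝ} {n : ℕ} {W : V → ℝ} {U : V →ᵇ ℝ}
    (hUW : ∀ x, U x = min (n : ℝ) (W x)) (hU : 0 ≤ U) (hk : G.kato T W < ENNReal.ofReal (1 / 2))
    {t : ℝ} (ht : t ∈ Set.Icc 0 T) (x : V) :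
    feynmanKac h ((2 : ℝ) • U) t 1 x ≤ 1 / (1 - 2 * (G.kato T W).toReal) := by
  have hfin := (hk.trans ENNReal.ofReal_lt_top).ne
  have hk' := (ENNReal.lt_ofReal_iff_toReal_lt hfin).1 hk
  refine (quasiPositive_lapCLM h).exp_smul_add_mul_one_le (lapCLM_one h)
    (fun y => mul_nonneg zero_le_two (hU y)) ht.1 (by linarith) (fun s hs y => ?_) x
  simp only [map_smul]
  change ∫ r in (0 : ℝ)..s, 2 * heatCLM h r U y ≤ _
  rw [intervalIntegral.integral_const_mul]
  exact mul_le_mul_of_nonneg_left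
    (integral_heatCLM_le_kato h hUW hU hfin ⟨hs.1, hs.2.trans ht.2⟩ y) zero_le_two

theorem exists_potential_of_kato {K T s : ℝ} {ρ : V → ℝ} (hs : 0 < s) (hCD : G.CD ρ ∞)
    (hk : G.kato T (fun x => -min 0 (ρ x - K)) < ENNReal.ofReal (1 / 4 * (1 - s))) :
    ∃ U : V →ᵇ ℝ, 0 ≤ U ∧ G.CD (fun x => K - U x) ∞ ∧
      ∀ t ∈ Set.Icc 0 T, ∀ x, feynmanKac h ((2 : ℝ) • U) t 1 x ≤ 2 / (1 + s) := by
  obtain ⟨n, hn⟩ := exists_nat_ge (K + G.degMax.toReal)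
  have hU0 (x : V) : 0 ≤ min (n : ℝ) (-min 0 (ρ x - K)) :=
    le_min n.cast_nonneg (neg_nonneg.2 (min_le_left _ _))
  let U : V →ᵇ ℝ := BoundedContinuousFunction.ofNormedAddCommGroupDiscrete
    (fun x => min (n : ℝ) (-min 0 (ρ x - K))) n fun x => by
      rw [Real.norm_of_nonneg (hU0 x)]; exact min_le_left _ _
  refine ⟨U, hU0, hCD.sub_min h hn, fun t ht x => ?_⟩
  have hk' := (ENNReal.lt_ofReal_iff_toReal_lt (hk.trans ENNReal.ofReal_lt_top).ne).1 hk
  refine (feynmanKac_one_le_of_kato h (U := U) (n := n) (fun _ => rfl) hU0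
    (hk.trans_le (ENNReal.ofReal_le_ofReal (by linarith))) ht x).trans ?_
  rw [div_le_div_iff₀ (by linarith) (by linarith)]
  linarith

/-- The bounds on the heat semigroup up to time `T` through which the curvature enters: `Γ` at most
doubles, by time `T` it has contracted by the factor `s ^ 2`, and `P_t` regularizes bounded
functions. -/
structure HeatGradientBounds (s T : ℝ) : Prop where
  bounded : ∀ t ∈ Set.Icc 0 T, ∀ (f : V →ᵇ ℝ) (C : ℝ), (∀ x, G.Γ f f x ≤ C) →
    ∀ x, G.Γ (heatCLM h t f) (heatCLM h t f) x ≤ 2 * C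
  contraction : ∀ (f : V →ᵇ ℝ) (C : ℝ), (∀ x, G.Γ f f x ≤ C) →
    ∀ x, G.Γ (heatCLM h T f) (heatCLM h T f) x ≤ s ^ 2 * C
  regularizing : ∀ t ∈ Set.Icc 0 T, ∀ f : V →ᵇ ℝ, (∀ x, |f x| ≤ 1) →
    ∀ x, t * G.Γ (heatCLM h t f) (heatCLM h t f) x ≤ 1

theorem heatGradientBounds_of_kato {K T : ℝ} {ρ : V → ℝ} (hK : 0 ≤ K) (hT : 0 ≤ T)
    (hCD : G.CD ρ ∞) (hk : G.kato T (fun x => -min 0 (ρ x - K)) <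
      ENNReal.ofReal (1 / 4 * (1 - Real.exp (-K * T / 2)))) :
    HeatGradientBounds h (Real.exp (-K * T / 2)) T := by
  obtain ⟨U, hU, hCDU, hM⟩ := exists_potential_of_kato h (Real.exp_pos _) hCD hk
  set s := Real.exp (-K * T / 2) with hs
  have hs0 : 0 < s := Real.exp_pos _
  have hs1 : s ≤ 1 := Real.exp_le_one_iff.2 (by nlinarith [mul_nonneg hK hT])
  have hM2 : 2 / (1 + s) ≤ 2 := div_le_self zero_le_two (by linarith)
  refine ⟨fun t ht f C hf x => ?_, fun f C hf x => ?_, fun t ht f hf x => ?_⟩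
  · have hC : 0 ≤ C := (G.Γ_self_nonneg f x).trans (hf x)
    refine (Γ_heatCLM_le h hCDU ht.1 (hM t ht) hf x).trans (mul_le_mul_of_nonneg_right ?_ hC)
    have hexp : Real.exp (-(2 * K * t)) ≤ 1 :=
      Real.exp_le_one_iff.2 (by nlinarith [mul_nonneg hK ht.1])
    exact (mul_le_of_le_one_left (by positivity) hexp).trans hM2
  · have hC : 0 ≤ C := (G.Γ_self_nonneg f x).trans (hf x)
    refine (Γ_heatCLM_le h hCDU hT (hM T ⟨hT, le_rfl⟩) hf x).trans
      (mul_le_mul_of_nonneg_right ?_ hC)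
    have hexp : Real.exp (-(2 * K * T)) = s ^ 2 * s ^ 2 := by
      rw [hs, ← Real.exp_nat_mul, ← Real.exp_add]; congr 1; push_cast; ring
    rw [hexp, mul_assoc]
    refine mul_le_of_le_one_right (by positivity) ?_
    rw [mul_div_assoc', div_le_one (by linarith)]
    nlinarith
  · have hCD' : G.CD (fun x => -U x) ∞ := hCDU.mono fun y => by
      change -U y ≤ K - U y
      linarith
    linarith [two_mul_mul_Γ_heatCLM_le h hU hCD' ht.1 (hM t ht) hf x]

end HeatSemigroup

section Oscillation

variable {V : Type*} {G : MWG V} [TopologicalSpace V] [DiscreteTopology V] {h : G.degMax < ∞}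
  {s T : ℝ}

namespace HeatGradientBounds

theorem dist_heatCLM_le (hG : HeatGradientBounds h s T) (hT : 0 ≤ T) {f : V →ᵇ ℝ} {C : ℝ}
    (hf : ∀ x, G.Γ f f x ≤ C) : dist f (heatCLM h T f) ≤ √(4 * G.degMax.toReal * C) * T := by
  have hD : 0 ≤ 2 * G.degMax.toReal := by positivity
  have hlap (t : ℝ) (ht : t ∈ Set.Icc 0 T) :
      ‖lapCLM h (heatCLM h t f)‖ ≤ √(4 * G.degMax.toReal * C) := by
    refine (BoundedContinuousFunction.norm_le (Real.sqrt_nonneg _)).2 fun x =>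
      Real.abs_le_sqrt ((G.lap_sq_le_degMax h _ x).trans ?_)
    linarith [mul_le_mul_of_nonneg_left (hG.bounded t ht f C hf x) hD]
  have hmean := (convex_Icc 0 T).norm_image_sub_le_of_norm_hasDerivWithin_le
    (fun t _ => (hasDerivAt_heatCLM h f t).hasDerivWithinAt) hlap ⟨le_rfl, hT⟩ ⟨hT, le_rfl⟩
  simpa [heatCLM_zero, dist_eq_norm', abs_of_nonneg hT] using hmean

theorem Γ_heatCLM_pow_le (hG : HeatGradientBounds h s T) {f : V →ᵇ ℝ} {C : ℝ}
    (hf : ∀ x, G.Γ f f x ≤ C) (n : ℕ) (x : V) :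
    G.Γ ((heatCLM h T ^ n) f) ((heatCLM h T ^ n) f) x ≤ (s ^ n) ^ 2 * C := by
  induction n generalizing x with
  | zero => simpa using hf x
  | succ n ih =>
    rw [pow_succ' (heatCLM h T), pow_succ' s, mul_pow, mul_assoc]
    exact hG.contraction _ _ ih x

theorem abs_sub_le (hG : HeatGradientBounds h s T) (hs0 : 0 ≤ s) (hs1 : s < 1) (hT : 0 ≤ T)
    {f : V →ᵇ ℝ} {C : ℝ} (hf : ∀ x, G.Γ f f x ≤ C) (x y : V) :
    |f x - f y| ≤ 2 * (√(4 * G.degMax.toReal * C) * T / (1 - s)) := by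
  set P : ℕ → V →ᵇ ℝ := fun n => (heatCLM h T ^ n) f with hP
  have hstep (n : ℕ) : dist (P n) (P (n + 1)) ≤ √(4 * G.degMax.toReal * C) * T * s ^ n := by
    simp only [hP, pow_succ' (heatCLM h T)]
    refine (hG.dist_heatCLM_le hT (hG.Γ_heatCLM_pow_le hf n)).trans_eq ?_
    rw [mul_left_comm, Real.sqrt_mul (sq_nonneg _), Real.sqrt_sq (pow_nonneg hs0 n)]
    ring
  obtain ⟨F, hF⟩ := cauchySeq_tendsto_of_complete (cauchySeq_of_le_geometric s _ hs1 hstep)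
  have hdist : dist f F ≤ √(4 * G.degMax.toReal * C) * T / (1 - s) :=
    dist_le_of_le_geometric_of_tendsto₀ s _ hs1 hstep hF
  have hΓF (z : V) : G.Γ F F z = 0 := by
    have hcont : Continuous fun g : V →ᵇ ℝ => ΓB h g g z := by
      unfold ΓB
      fun_prop
    have hzero : Filter.Tendsto (fun n => (s ^ n) ^ 2 * C) Filter.atTop (nhds 0) := by
      simpa using ((tendsto_pow_atTop_nhds_zero_of_lt_one hs0 hs1).pow 2).mul_const C
    exact (le_of_tendsto_of_tendsto' ((hcont.tendsto F).comp hF) hzero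
      fun n => hG.Γ_heatCLM_pow_le hf n z).antisymm (G.Γ_self_nonneg F z)
  calc |f x - f y| ≤ |f x - F x| + |F x - f y| := _root_.abs_sub_le _ _ _
    _ = dist (f x) (F x) + dist (f y) (F y) := by
        rw [G.eq_of_Γ_eq_zero hΓF y x, abs_sub_comm (F y)]
        rfl
    _ ≤ dist f F + dist f F :=
        add_le_add (BoundedContinuousFunction.dist_coe_le_dist x)
          (BoundedContinuousFunction.dist_coe_le_dist y)
    _ ≤ 2 * (√(4 * G.degMax.toReal * C) * T / (1 - s)) := by linarith

end HeatGradientBounds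

end Oscillation

section Finiteness

variable {V : Type*} (G : MWG V)

/-- The underlying simple graph, whose distance is the combinatorial distance of `G`. -/
def toSimpleGraph : SimpleGraph V where
  Adj x y := 0 < G.w x y
  symm := ⟨fun x y h => by rwa [G.w_symm]⟩
  loopless := ⟨fun x h => by simp [G.w_diag] at h⟩

theorem toSimpleGraph_preconnected : G.toSimpleGraph.Preconnected := fun x y =>
  (SimpleGraph.reachable_iff_reflTransGen x y).2 (G.connected x y)

theorem finite_setOf_walk_length_eq (x₀ : V) (n : ℕ) :
    {y | ∃ p : G.toSimpleGraph.Walk y x₀, p.length = n}.Finite := by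
  induction n with
  | zero =>
    refine (Set.finite_singleton x₀).subset ?_
    rintro y ⟨p, hp⟩
    exact SimpleGraph.Walk.eq_of_length_eq_zero hp
  | succ n ih =>
    refine (ih.biUnion fun y _ => G.locally_finite y).subset ?_
    rintro y ⟨p, hp⟩
    cases p with
    | nil => simp at hp
    | @cons _ z _ hyz p =>
      refine Set.mem_biUnion (show z ∈ _ from ⟨p, Nat.succ.inj hp⟩) ?_
      exact SimpleGraph.Adj.symm hyz

theorem finite_of_dist_le (x₀ : V) {R : ℝ} (h : ∀ y, (G.toSimpleGraph.dist y x₀ : ℝ) ≤ R) :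
    Finite V := by
  have hfin : (⋃ n ∈ Finset.range (⌊R⌋₊ + 1),
      {y | ∃ p : G.toSimpleGraph.Walk y x₀, p.length = n}).Finite :=
    Set.Finite.biUnion (Finset.finite_toSet _) fun n _ => G.finite_setOf_walk_length_eq x₀ n
  refine Set.finite_univ_iff.1 (hfin.subset fun y _ => ?_)
  obtain ⟨p, hp⟩ := (G.toSimpleGraph_preconnected y x₀).exists_walk_length_eq_dist
  refine Set.mem_biUnion (x := p.length) ?_ ⟨p, rfl⟩
  rw [hp]
  simpa [Nat.lt_succ_iff] using Nat.le_floor (h y)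

theorem abs_dist_sub_dist_le_one (x₀ : V) {x y : V} (h : 0 < G.w x y) :
    |(G.toSimpleGraph.dist y x₀ : ℝ) - G.toSimpleGraph.dist x x₀| ≤ 1 := by
  have hconn : G.toSimpleGraph.Connected :=
    { preconnected := G.toSimpleGraph_preconnected, nonempty := ⟨x⟩ }
  have hxy : G.toSimpleGraph.dist x y = 1 := SimpleGraph.dist_eq_one_iff_adj.2 h
  have hyx : G.toSimpleGraph.dist y x = 1 := SimpleGraph.dist_comm.trans hxy
  have hx : (G.toSimpleGraph.dist x x₀ : ℝ) ≤ 1 + G.toSimpleGraph.dist y x₀ := by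
    exact_mod_cast hxy ▸ hconn.dist_triangle (u := x) (v := y) (w := x₀)
  have hy : (G.toSimpleGraph.dist y x₀ : ℝ) ≤ 1 + G.toSimpleGraph.dist x x₀ := by
    exact_mod_cast hyx ▸ hconn.dist_triangle (u := y) (v := x) (w := x₀)
  exact abs_le.2 ⟨by linarith, by linarith⟩

theorem Γ_self_le_of_abs_sub_le_one {f : V → ℝ} {x : V}
    (hf : ∀ y, 0 < G.w x y → |f y - f x| ≤ 1) : G.Γ f f x ≤ G.deg x / 2 := by
  have hsum : ∑ y ∈ G.nbr x, G.q x y * ((f y - f x) * (f y - f x)) ≤ G.deg x :=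
    Finset.sum_le_sum fun y hy => mul_le_of_le_one_right (G.q_nonneg x y) <| by
      simpa only [sq] using (sq_le_one_iff_abs_le_one _).2 (hf y (G.mem_nbr.1 hy))
  rw [Γ_eq_sum]
  linarith

variable {G} [TopologicalSpace V] [DiscreteTopology V] {h : G.degMax < ∞} {s T : ℝ}

theorem HeatGradientBounds.dist_le (hG : HeatGradientBounds h s T) (hs0 : 0 ≤ s) (hs1 : s < 1)
    (hT : 0 ≤ T) (x₀ y : V) :
    (G.toSimpleGraph.dist y x₀ : ℝ) ≤
      2 * (√(4 * G.degMax.toReal * (G.degMax.toReal / 2)) * T / (1 - s)) := by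
  set R : ℝ := ((G.toSimpleGraph.dist y x₀ : ℕ) : ℝ) with hR
  have hR0 : 0 ≤ R := Nat.cast_nonneg _
  let f : V →ᵇ ℝ := BoundedContinuousFunction.ofNormedAddCommGroupDiscrete
    (fun z => min (G.toSimpleGraph.dist z x₀ : ℝ) R) R fun z => by
      rw [Real.norm_of_nonneg (le_min (Nat.cast_nonneg _) hR0)]; exact min_le_right _ _
  have hΓ (x : V) : G.Γ f f x ≤ G.degMax.toReal / 2 := by
    refine (G.Γ_self_le_of_abs_sub_le_one fun z hz => ?_).trans
      (div_le_div_of_nonneg_right (G.deg_le_toReal_degMax h x) zero_le_two)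
    refine (abs_min_sub_min_le_max _ _ _ _).trans ?_
    simpa using G.abs_dist_sub_dist_le_one x₀ hz
  have hosc := hG.abs_sub_le hs0 hs1 hT hΓ y x₀
  simpa [f, ← hR, hR0, abs_of_nonneg hR0] using hosc

theorem HeatGradientBounds.finite (hG : HeatGradientBounds h s T) (hs0 : 0 ≤ s) (hs1 : s < 1)
    (hT : 0 ≤ T) : Finite V := by
  rcases isEmpty_or_nonempty V with _ | ⟨⟨x₀⟩⟩
  · infer_instance
  · exact G.finite_of_dist_le x₀ (hG.dist_le hs0 hs1 hT x₀)

end Finiteness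

section Green

variable {V : Type*} (G : MWG V) [Fintype V]

theorem m_mul_sum_nbr (F : V → ℝ) (x : V) :
    G.m x * ∑ y ∈ G.nbr x, G.q x y * F y = ∑ y, G.w x y * F y := by
  rw [Finset.sum_subset (Finset.subset_univ _) fun y _ hy => ?_, Finset.mul_sum]
  · refine Finset.sum_congr rfl fun y _ => ?_
    rw [← mul_assoc, q, mul_div_cancel₀ _ (G.m_pos x).ne']
  · have hw : G.w x y = 0 :=
      (not_lt.1 fun hxy => hy (G.mem_nbr.2 hxy)).antisymm (G.w_nonneg x y)
    rw [q, hw, zero_div, zero_mul]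

theorem sum_m_mul_Γ (f g : V → ℝ) :
    ∑ x, G.m x * G.Γ f g x = 1 / 2 * ∑ x, ∑ y, G.w x y * ((f y - f x) * (g y - g x)) := by
  rw [Finset.mul_sum]
  refine Finset.sum_congr rfl fun x _ => ?_
  rw [Γ_eq_sum, mul_left_comm, m_mul_sum_nbr]

theorem sum_sum_w_comm (F : V → V → ℝ) :
    ∑ x, ∑ y, G.w x y * F x y = ∑ x, ∑ y, G.w x y * F y x := by
  rw [Finset.sum_comm]
  simp only [G.w_symm]

theorem sum_m_mul_lap (f g : V → ℝ) :
    ∑ x, G.m x * (g x * G.lap f x) = -∑ x, G.m x * G.Γ f g x := by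
  have hlap : ∑ x, G.m x * (g x * G.lap f x) = ∑ x, ∑ y, G.w x y * (g x * (f y - f x)) := by
    refine Finset.sum_congr rfl fun x _ => ?_
    rw [lap, mul_left_comm, m_mul_sum_nbr, Finset.mul_sum]
    exact Finset.sum_congr rfl fun y _ => mul_left_comm _ _ _
  have hΓ : ∑ x, ∑ y, G.w x y * ((f y - f x) * (g y - g x))
      = -(∑ x, ∑ y, G.w x y * (g x * (f y - f x)) + ∑ x, ∑ y, G.w x y * (g y * (f x - f y))) := by
    simp only [← Finset.sum_add_distrib, ← Finset.sum_neg_distrib]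
    exact Finset.sum_congr rfl fun x _ => Finset.sum_congr rfl fun y _ => by ring
  rw [sum_m_mul_Γ, hΓ, ← G.sum_sum_w_comm fun x y => g x * (f y - f x), hlap]
  ring

theorem sum_m_mul_lap_eq_zero (f : V → ℝ) : ∑ x, G.m x * G.lap f x = 0 := by
  simpa [Γ_eq_sum] using G.sum_m_mul_lap f 1

end Green

section Spectral

variable {V : Type*} {G : MWG V} [Fintype V] [TopologicalSpace V] [DiscreteTopology V]
  (h : G.degMax < ∞)

variable (G) in
/-- The identification of Euclidean space with `L²(V, m)`, whose vectors are written as functions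
on `V`. It turns `-Δ` into a symmetric operator. -/
noncomputable def ofEuclidean : EuclideanSpace ℝ V ≃ₗ[ℝ] (V →ᵇ ℝ) where
  toFun u := .mkOfCompact ⟨fun x => (√(G.m x))⁻¹ * u x, continuous_of_discreteTopology⟩
  invFun f := WithLp.toLp 2 fun x => √(G.m x) * f x
  map_add' u v := by ext x; simp [mul_add]
  map_smul' c u := by ext x; simp [mul_left_comm]
  left_inv u := by
    ext x
    exact mul_inv_cancel_left₀ (Real.sqrt_pos.2 (G.m_pos x)).ne' _
  right_inv f := by
    ext x
    exact inv_mul_cancel_left₀ (Real.sqrt_pos.2 (G.m_pos x)).ne' _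

theorem inner_ofEuclidean_symm (f g : V →ᵇ ℝ) :
    inner ℝ ((ofEuclidean G).symm f) ((ofEuclidean G).symm g) = ∑ x, G.m x * (f x * g x) := by
  rw [PiLp.inner_apply]
  refine Finset.sum_congr rfl fun x _ => ?_
  change √(G.m x) * g x * (√(G.m x) * f x) = _
  linear_combination f x * g x * Real.mul_self_sqrt (G.m_pos x).le

theorem isSymmetric_conj_neg_lapCLM :
    ((ofEuclidean G).symm.conj (-(lapCLM h : (V →ᵇ ℝ) →ₗ[ℝ] (V →ᵇ ℝ)))).IsSymmetric := by
  have hinner (f g : V →ᵇ ℝ) : inner ℝ ((ofEuclidean G).symm (-lapCLM h f))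
      ((ofEuclidean G).symm g) = ∑ x, G.m x * G.Γ f g x := by
    rw [inner_ofEuclidean_symm, ← neg_eq_iff_eq_neg.2 (G.sum_m_mul_lap f g),
      ← Finset.sum_neg_distrib]
    refine Finset.sum_congr rfl fun x _ => ?_
    change G.m x * (-G.lap f x * g x) = _
    ring
  intro u v
  obtain ⟨f, rfl⟩ := (ofEuclidean G).symm.surjective u
  obtain ⟨g, rfl⟩ := (ofEuclidean G).symm.surjective v
  rw [real_inner_comm ((ofEuclidean G).symm.conj _ _)]
  simp only [LinearEquiv.conj_apply_apply, LinearEquiv.symm_symm, LinearEquiv.apply_symm_apply]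
  refine (hinner f g).trans ((Finset.sum_congr rfl fun x _ => ?_).trans (hinner g f).symm)
  simp only [Γ_eq_sum, mul_comm (f _ - f _)]

/-- An orthonormal basis of `L²(V, m)` consisting of eigenfunctions of `-Δ`. -/
structure Eigenbasis where
  eigenvalue : Fin (Fintype.card V) → ℝ
  eigenfunction : Fin (Fintype.card V) → V →ᵇ ℝ
  lapCLM_eigenfunction : ∀ i, lapCLM h (eigenfunction i) = -eigenvalue i • eigenfunction i
  sum_m_mul_sq : ∀ i, ∑ x, G.m x * eigenfunction i x ^ 2 = 1
  expansion : ∀ f : V →ᵇ ℝ,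
    ∑ i, (∑ x, G.m x * (eigenfunction i x * f x)) • eigenfunction i = f

theorem nonempty_eigenbasis : Nonempty (Eigenbasis h) := by
  set S := ofEuclidean G
  have hsymm := isSymmetric_conj_neg_lapCLM h
  set b := hsymm.eigenvectorBasis finrank_euclideanSpace
  refine ⟨hsymm.eigenvalues finrank_euclideanSpace, fun i => S (b i), fun i => ?_, fun i => ?_,
    fun f => ?_⟩
  · have hb := congrArg S (hsymm.apply_eigenvectorBasis finrank_euclideanSpace i)
    rw [LinearEquiv.conj_apply_apply, LinearEquiv.apply_symm_apply, map_smul] at hb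
    rw [neg_smul]
    exact neg_eq_iff_eq_neg.1 hb
  · have hb := inner_ofEuclidean_symm (G := G) (S (b i)) (S (b i))
    rw [LinearEquiv.symm_apply_apply, real_inner_self_eq_norm_sq, b.norm_eq_one, one_pow] at hb
    simp only [sq, ← hb]
  · have hb := congrArg S (b.sum_repr' (S.symm f))
    rw [LinearEquiv.apply_symm_apply, map_sum] at hb
    refine (Finset.sum_congr rfl fun i _ => ?_).trans hb
    rw [map_smul, ← inner_ofEuclidean_symm, LinearEquiv.symm_apply_apply]

variable {h}

namespace Eigenbasis

/-- The coefficient of `f` at the `i`-th eigenfunction. -/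
noncomputable def coeff (b : Eigenbasis h) (i : Fin (Fintype.card V)) (f : V → ℝ) : ℝ :=
  ∑ x, G.m x * (b.eigenfunction i x * f x)

theorem lap_eigenfunction (b : Eigenbasis h) (i : Fin (Fintype.card V)) (x : V) :
    G.lap (b.eigenfunction i) x = -b.eigenvalue i * b.eigenfunction i x :=
  DFunLike.congr_fun (b.lapCLM_eigenfunction i) x

theorem sum_m_mul_Γ_eigenfunction (b : Eigenbasis h) (i : Fin (Fintype.card V)) :
    ∑ x, G.m x * G.Γ (b.eigenfunction i) (b.eigenfunction i) x = b.eigenvalue i := by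
  rw [← neg_eq_iff_eq_neg.2 (G.sum_m_mul_lap _ _), ← Finset.sum_neg_distrib,
    ← mul_one (b.eigenvalue i), ← b.sum_m_mul_sq i, Finset.mul_sum]
  refine Finset.sum_congr rfl fun x _ => ?_
  rw [lap_eigenfunction]
  ring

theorem eigenvalue_nonneg (b : Eigenbasis h) (i : Fin (Fintype.card V)) : 0 ≤ b.eigenvalue i :=
  b.sum_m_mul_Γ_eigenfunction i ▸
    Finset.sum_nonneg fun x _ => mul_nonneg (G.m_pos x).le (G.Γ_self_nonneg _ x)

theorem eigenfunction_apply_eq (b : Eigenbasis h) {i : Fin (Fintype.card V)}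
    (hi : b.eigenvalue i = 0) (x y : V) : b.eigenfunction i y = b.eigenfunction i x := by
  have hsum := (Finset.sum_eq_zero_iff_of_nonneg fun x _ =>
    mul_nonneg (G.m_pos x).le (G.Γ_self_nonneg _ x)).1 ((b.sum_m_mul_Γ_eigenfunction i).trans hi)
  exact G.eq_of_Γ_eq_zero
    (fun z => (mul_eq_zero.1 (hsum z (Finset.mem_univ z))).resolve_left (G.m_pos z).ne') x y

theorem sum_m_mul_eigenfunction (b : Eigenbasis h) {i : Fin (Fintype.card V)}
    (hi : b.eigenvalue i ≠ 0) : ∑ x, G.m x * b.eigenfunction i x = 0 := by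
  have hlap := G.sum_m_mul_lap_eq_zero (b.eigenfunction i)
  simp only [lap_eigenfunction, mul_left_comm (G.m _), ← Finset.mul_sum] at hlap
  exact (mul_eq_zero.1 hlap).resolve_left (neg_ne_zero.2 hi)

theorem isEigenvalue (b : Eigenbasis h) (i : Fin (Fintype.card V)) :
    G.IsEigenvalue (b.eigenvalue i) := by
  refine ⟨b.eigenfunction i, fun h0 => ?_, Summable.of_finite, fun x => ?_⟩
  · simpa [h0] using b.sum_m_mul_sq i
  · rw [lap_eigenfunction]
    ring

theorem sum_m_mul_heatCLM (b : Eigenbasis h) (f : V →ᵇ ℝ) (t : ℝ) :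
    ∑ x, G.m x * (f x * heatCLM h t f x)
      = ∑ i, Real.exp (-(b.eigenvalue i * t)) * b.coeff i f ^ 2 := by
  have heigen (i) : heatCLM h t (b.eigenfunction i)
      = Real.exp (-(b.eigenvalue i * t)) • b.eigenfunction i :=
    exp_apply_of_apply_eq_smul <| by
      rw [smul_apply, b.lapCLM_eigenfunction, smul_smul]
      congr 1
      ring
  have hheat (x : V) : heatCLM h t f x
      = ∑ i, b.coeff i f * (Real.exp (-(b.eigenvalue i * t)) * b.eigenfunction i x) := by
    conv_lhs => rw [← b.expansion f]
    simp [map_sum, heigen, coeff]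
  simp only [hheat, Finset.mul_sum]
  rw [Finset.sum_comm]
  refine Finset.sum_congr rfl fun i _ => ?_
  rw [sq, coeff, Finset.mul_sum, Finset.mul_sum]
  exact Finset.sum_congr rfl fun x _ => by ring

theorem sum_m_mul_sq_eq (b : Eigenbasis h) (f : V →ᵇ ℝ) :
    ∑ x, G.m x * f x ^ 2 = ∑ i, b.coeff i f ^ 2 := by
  simpa [heatCLM_zero, ← sq] using b.sum_m_mul_heatCLM f 0

end Eigenbasis

end Spectral

section SpectralGap

variable {V : Type*} {G : MWG V}

theorem ofReal_le_lambda1_iff {lam : ℝ} :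
    ENNReal.ofReal lam ≤ G.lambda1 ↔ ∀ μ, 0 < μ → G.IsEigenvalue μ → lam ≤ μ := by
  simp only [lambda1, le_iInf_iff, and_imp]
  exact forall₂_congr fun μ hμ => imp_congr_right fun _ => ENNReal.ofReal_le_ofReal_iff hμ.le

variable [TopologicalSpace V] [DiscreteTopology V] {h : G.degMax < ∞} {s T : ℝ}

namespace HeatGradientBounds

theorem exp_neg_mul_le [Finite V] (hG : HeatGradientBounds h s T) (hs : 0 ≤ s) {μ : ℝ} (hμ : μ ≠ 0)
    (hE : G.IsEigenvalue μ) : Real.exp (-(μ * T)) ≤ s := by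
  obtain ⟨φ, hφ0, -, hφ⟩ := hE
  obtain ⟨z, hz⟩ := Function.ne_iff.1 hφ0
  have : Nonempty V := ⟨z⟩
  let f : V →ᵇ ℝ := .mkOfCompact ⟨φ, continuous_of_discreteTopology⟩
  obtain ⟨x, hx⟩ := Finite.exists_max (G.Γ φ φ)
  have hpos : 0 < G.Γ φ φ x := by
    refine (G.Γ_self_nonneg φ x).lt_of_ne' fun h0 => hz ?_
    have hΓ (y : V) : G.Γ φ φ y = 0 := ((hx y).trans h0.le).antisymm (G.Γ_self_nonneg φ y)
    have := hφ z
    rw [G.lap_eq_zero_of_Γ_eq_zero hΓ, neg_zero] at this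
    exact (mul_eq_zero.1 this.symm).resolve_left hμ
  have heigen : heatCLM h T f = Real.exp (-(μ * T)) • f := exp_apply_of_apply_eq_smul <| by
    ext y
    change T * G.lap φ y = -(μ * T) * φ y
    linear_combination -T * hφ y
  have hcontr := hG.contraction f _ hx x
  rw [heigen] at hcontr
  exact (pow_le_pow_iff_left₀ (Real.exp_pos _).le hs two_ne_zero).1
    (le_of_mul_le_mul_right ((G.Γ_const_mul _ φ x).symm.trans_le hcontr) hpos)

theorem ofReal_neg_log_div_le_lambda1 [Finite V] (hG : HeatGradientBounds h s T) (hs : 0 < s)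
    (hT : 0 < T) : ENNReal.ofReal (-Real.log s / T) ≤ G.lambda1 := by
  refine ofReal_le_lambda1_iff.2 fun μ hμ hE => ?_
  have hlog := (Real.le_log_iff_exp_le hs).2 (hG.exp_neg_mul_le hs.le hμ.ne' hE)
  rw [div_le_iff₀ hT]
  linarith

end HeatGradientBounds

end SpectralGap

section Variance

variable {V : Type*} {G : MWG V} [Fintype V]

variable (G) in
/-- The average of `f` with respect to `m`. -/
noncomputable def mean (f : V → ℝ) : ℝ := (∑ x, G.m x * f x) / ∑ x, G.m x

theorem sum_m_pos [Nonempty V] : 0 < ∑ x, G.m x :=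
  Finset.sum_pos (fun x _ => G.m_pos x) Finset.univ_nonempty

theorem sum_m_mul_sub_mean [Nonempty V] (f : V → ℝ) :
    ∑ x, G.m x * (f x - G.mean f) = 0 := by
  simp only [mul_sub, Finset.sum_sub_distrib, ← Finset.sum_mul, mean]
  rw [mul_div_cancel₀ _ sum_m_pos.ne', sub_self]

variable [TopologicalSpace V] [DiscreteTopology V] {h : G.degMax < ∞}

theorem Eigenbasis.one_sub_exp_mul_coeff_sq_le [Nonempty V] (b : Eigenbasis h) {lam t : ℝ}
    (hlam : ENNReal.ofReal lam ≤ G.lambda1) (ht : 0 ≤ t) (f : V → ℝ)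
    (i : Fin (Fintype.card V)) :
    (1 - Real.exp (-(lam * t))) * b.coeff i (fun x => f x - G.mean f) ^ 2
      ≤ (1 - Real.exp (-(b.eigenvalue i * t))) * b.coeff i f ^ 2 := by
  rcases eq_or_ne (b.eigenvalue i) 0 with hi | hi
  · have hcoeff : b.coeff i (fun x => f x - G.mean f) = 0 := by
      obtain ⟨z⟩ := ‹Nonempty V›
      simp only [coeff, b.eigenfunction_apply_eq hi z, mul_left_comm (G.m _), ← Finset.mul_sum]
      rw [sum_m_mul_sub_mean, mul_zero]
    simp [hcoeff, hi]
  · have hcoeff : b.coeff i (fun x => f x - G.mean f) = b.coeff i f := by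
      simp only [coeff, mul_sub, Finset.sum_sub_distrib, ← mul_assoc, ← Finset.sum_mul]
      rw [b.sum_m_mul_eigenfunction hi, zero_mul, sub_zero]
    rw [hcoeff]
    gcongr
    exact ofReal_le_lambda1_iff.1 hlam _ ((b.eigenvalue_nonneg i).lt_of_ne' hi) (b.isEigenvalue i)

variable (h) in
theorem one_sub_exp_mul_variance_le [Nonempty V] {lam t : ℝ}
    (hlam : ENNReal.ofReal lam ≤ G.lambda1) (ht : 0 ≤ t) (f : V →ᵇ ℝ) :
    (1 - Real.exp (-(lam * t))) * ∑ x, G.m x * (f x - G.mean f) ^ 2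
      ≤ ∑ x, G.m x * (f x * (f x - heatCLM h t f x)) := by
  obtain ⟨b⟩ := nonempty_eigenbasis h
  have hvar := b.sum_m_mul_sq_eq (f - G.mean f • (1 : V →ᵇ ℝ))
  simp only [BoundedContinuousFunction.coe_sub, BoundedContinuousFunction.coe_smul, Pi.sub_apply,
    BoundedContinuousFunction.coe_one, Pi.one_apply, smul_eq_mul, mul_one] at hvar
  calc (1 - Real.exp (-(lam * t))) * ∑ x, G.m x * (f x - G.mean f) ^ 2
      = ∑ i, (1 - Real.exp (-(lam * t))) * b.coeff i (fun x => f x - G.mean f) ^ 2 := by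
        rw [hvar, Finset.mul_sum]
        rfl
    _ ≤ ∑ i, (1 - Real.exp (-(b.eigenvalue i * t))) * b.coeff i f ^ 2 :=
        Finset.sum_le_sum fun i _ => b.one_sub_exp_mul_coeff_sq_le hlam ht f i
    _ = ∑ x, G.m x * f x ^ 2 - ∑ x, G.m x * (f x * heatCLM h t f x) := by
        rw [b.sum_m_mul_sq_eq, b.sum_m_mul_heatCLM, ← Finset.sum_sub_distrib]
        simp only [sub_mul, one_mul]
    _ = ∑ x, G.m x * (f x * (f x - heatCLM h t f x)) := by
        rw [← Finset.sum_sub_distrib]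
        exact Finset.sum_congr rfl fun x _ => by ring

end Variance

section ShortTime

variable {V : Type*} {G : MWG V} [TopologicalSpace V] [DiscreteTopology V] {h : G.degMax < ∞}
  {s T : ℝ}

theorem HeatGradientBounds.Γ_heatCLM_le_sqrt_div (hG : HeatGradientBounds h s T) {f : V →ᵇ ℝ}
    (hf : ∀ x, |f x| ≤ 1) {t : ℝ} (ht : t ∈ Set.Ioc 0 T) (x : V) :
    G.Γ (heatCLM h t f) f x ≤ √(G.Γ f f x) / √t := by
  rw [← Real.sqrt_div (G.Γ_self_nonneg f x)]
  refine Real.le_sqrt_of_sq_le ((G.Γ_sq_le _ f x).trans ?_)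
  rw [le_div_iff₀ ht.1, mul_right_comm, mul_comm _ t]
  exact mul_le_of_le_one_left (G.Γ_self_nonneg f x)
    (hG.regularizing t (Set.Ioc_subset_Icc_self ht) f hf x)

theorem HeatGradientBounds.sum_m_mul_sub_heatCLM_le [Fintype V] (hG : HeatGradientBounds h s T)
    {f : V →ᵇ ℝ} (hf : ∀ x, |f x| ≤ 1) {t : ℝ} (ht : t ∈ Set.Icc 0 T) :
    ∑ x, G.m x * (f x * (f x - heatCLM h t f x)) ≤ 2 * √t * ∑ x, G.m x * √(G.Γ f f x) := by
  set S := ∑ x, G.m x * √(G.Γ f f x)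
  set F : ℝ → ℝ := fun r => 2 * √r * S - ∑ x, G.m x * (f x * (f x - heatCLM h r f x)) with hF
  have hsum (r : ℝ) : HasDerivAt (fun r => ∑ x, G.m x * (f x * (f x - heatCLM h r f x)))
      (∑ x, G.m x * G.Γ (heatCLM h r f) f x) r := by
    rw [← neg_eq_iff_eq_neg.2 (G.sum_m_mul_lap _ _), ← Finset.sum_neg_distrib]
    refine HasDerivAt.fun_sum fun x _ => ?_
    simpa using! (((hasDerivAt_apply (hasDerivAt_heatCLM h f r) x).const_sub (f x)).const_mul
      (f x)).const_mul (G.m x)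
  have hsqrt {r : ℝ} (hr : 0 < r) : HasDerivAt (fun r => 2 * √r * S) (S / √r) r := by
    refine (((Real.hasDerivAt_sqrt hr.ne').const_mul 2).mul_const S).congr_deriv ?_
    field_simp
  have hmono : MonotoneOn F (Set.Icc 0 t) := by
    refine monotoneOn_of_hasDerivWithinAt_nonneg (convex_Icc 0 t)
      (ContinuousOn.sub (by fun_prop) fun r _ => (hsum r).continuousAt.continuousWithinAt)
      (f' := fun r => S / √r - ∑ x, G.m x * G.Γ (heatCLM h r f) f x) (fun r hr => ?_)
      fun r hr => ?_
    all_goals rw [interior_Icc] at hr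
    · exact ((hsqrt hr.1).sub (hsum r)).hasDerivWithinAt
    · rw [sub_nonneg, Finset.sum_div]
      refine Finset.sum_le_sum fun x _ => ?_
      rw [mul_div_assoc]
      exact mul_le_mul_of_nonneg_left
        (hG.Γ_heatCLM_le_sqrt_div hf ⟨hr.1, hr.2.le.trans ht.2⟩ x) (G.m_pos x).le
  simpa [hF, heatCLM_zero] using hmono ⟨le_rfl, ht.1⟩ ⟨ht.1, le_rfl⟩ ht.1

end ShortTime

section Cheeger

variable {V : Type*} {G : MWG V}

theorem sqrt_Γ_le {f : V → ℝ} {x : V} {q₀ : ℝ} (hq₀ : 0 < q₀)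
    (hq : ∀ y, 0 < G.w x y → q₀ ≤ G.q x y)
    (hf : ∀ y, f y = f x ∨ 1 ≤ (f y - f x) ^ 2) :
    √(G.Γ f f x) ≤ √(2 / q₀) * G.Γ f f x := by
  have hΓ := G.Γ_self_nonneg f x
  rcases hΓ.eq_or_lt' with h0 | hpos
  · simp [h0]
  obtain ⟨y, hy, hyx⟩ : ∃ y ∈ G.nbr x, G.q x y * ((f y - f x) * (f y - f x)) ≠ 0 := by
    refine Finset.exists_ne_zero_of_sum_ne_zero fun hsum => hpos.ne' ?_
    rw [Γ_eq_sum, hsum, mul_zero]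
  have hxy := G.mem_nbr.1 hy
  have hjump : 1 ≤ (f y - f x) ^ 2 := (hf y).resolve_left fun he => hyx (by simp [he])
  have hlower : 1 ≤ 2 / q₀ * G.Γ f f x := by
    rw [div_mul_eq_mul_div, one_le_div hq₀]
    calc q₀ ≤ G.q x y := hq y hxy
      _ ≤ G.q x y * (f y - f x) ^ 2 := le_mul_of_one_le_right (G.q_nonneg x y) hjump
      _ ≤ 2 * G.Γ f f x := G.q_mul_sq_le_two_mul_Γ f hxy
  calc √(G.Γ f f x) ≤ √(2 / q₀ * G.Γ f f x) * √(G.Γ f f x) :=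
        le_mul_of_one_le_left (Real.sqrt_nonneg _) (Real.one_le_sqrt.2 hlower)
    _ = √(2 / q₀) * G.Γ f f x := by
        rw [Real.sqrt_mul' _ hΓ, mul_assoc, Real.mul_self_sqrt hΓ]

theorem exists_w_pos [Nontrivial V] (x : V) : ∃ y, 0 < G.w x y := by
  obtain ⟨z, hz⟩ := exists_ne x
  rcases (G.connected x z).cases_head with h | ⟨y, hy, -⟩
  · exact absurd h.symm hz
  · exact ⟨y, hy⟩

theorem qInf_le {x y : V} (h : 0 < G.w x y) : G.qInf ≤ ENNReal.ofReal (G.q x y) :=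
  iInf₂_le_of_le x y (iInf_le _ h)

theorem qInf_ne_top [Nontrivial V] : G.qInf ≠ ∞ := by
  obtain ⟨x⟩ := ‹Nontrivial V›.to_nonempty
  obtain ⟨y, hy⟩ := G.exists_w_pos x
  exact ((qInf_le hy).trans_lt ENNReal.ofReal_lt_top).ne

theorem qInf_pos [Finite V] : 0 < G.qInf := by
  rcases {p : V × V | 0 < G.w p.1 p.2}.eq_empty_or_nonempty with hE | hE
  · have hw (x y : V) : ¬ 0 < G.w x y := fun hxy => hE.le (show (x, y) ∈ _ from hxy)
    simp [qInf, hw]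
  · obtain ⟨p, hp, hmin⟩ := Set.exists_min_image _ (fun p : V × V => G.q p.1 p.2)
      (Set.toFinite _) hE
    refine (ENNReal.ofReal_pos.2 (G.q_pos hp)).trans_le ?_
    exact le_iInf₂ fun x y => le_iInf fun hxy => ENNReal.ofReal_le_ofReal (hmin (x, y) hxy)

variable [Fintype V] (U : Set V)

theorem vol_eq_ofReal : G.vol U = ENNReal.ofReal (∑ x, G.m x * U.indicator 1 x) := by
  rw [vol, tsum_subtype U fun x => ENNReal.ofReal (G.m x), tsum_fintype,
    ENNReal.ofReal_sum_of_nonneg fun x _ =>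
      mul_nonneg (G.m_pos x).le (Set.indicator_nonneg (by simp) x)]
  refine Finset.sum_congr rfl fun x _ => ?_
  by_cases hx : x ∈ U <;> simp [hx]

theorem sum_m_mul_Γ_indicator :
    ∑ x, G.m x * G.Γ (U.indicator 1) (U.indicator 1) x
      = ∑ x, ∑ y, G.w x y * (U.indicator 1 x * (1 - U.indicator 1 y)) := by
  have hsplit : ∑ x, ∑ y, G.w x y *
        ((U.indicator 1 y - U.indicator 1 x) * (U.indicator 1 y - U.indicator 1 x))
      = ∑ x, ∑ y, G.w x y * (U.indicator 1 x * (1 - U.indicator 1 y))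
        + ∑ x, ∑ y, G.w x y * (U.indicator 1 y * (1 - U.indicator 1 x)) := by
    simp only [← Finset.sum_add_distrib]
    refine Finset.sum_congr rfl fun x _ => Finset.sum_congr rfl fun y _ => ?_
    by_cases hx : x ∈ U <;> by_cases hy : y ∈ U <;> simp [hx, hy]
  rw [sum_m_mul_Γ, hsplit, ← G.sum_sum_w_comm fun x y => U.indicator 1 x * (1 - U.indicator 1 y)]
  ring

theorem boundary_eq_ofReal :
    G.boundary U = ENNReal.ofReal (∑ x, G.m x * G.Γ (U.indicator 1) (U.indicator 1) x) := by
  have hnonneg (x y : V) : 0 ≤ G.w x y * (U.indicator 1 x * (1 - U.indicator 1 y)) := by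
    refine mul_nonneg (G.w_nonneg x y) ?_
    by_cases hx : x ∈ U <;> by_cases hy : y ∈ U <;> simp [hx, hy]
  rw [sum_m_mul_Γ_indicator, boundary,
    tsum_subtype U fun x => ∑' y : (Uᶜ : Set V), ENNReal.ofReal (G.w x y), tsum_fintype,
    ENNReal.ofReal_sum_of_nonneg fun x _ => Finset.sum_nonneg fun y _ => hnonneg x y]
  refine Finset.sum_congr rfl fun x _ => ?_
  rw [ENNReal.ofReal_sum_of_nonneg fun y _ => hnonneg x y]
  by_cases hx : x ∈ U
  · rw [Set.indicator_of_mem hx, tsum_subtype Uᶜ fun y => ENNReal.ofReal (G.w x y), tsum_fintype]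
    refine Finset.sum_congr rfl fun y _ => ?_
    by_cases hy : y ∈ U <;> simp [hx, hy]
  · simp [hx]

variable {U}

theorem sum_m_mul_indicator_pos (hU : U.Nonempty) : 0 < ∑ x, G.m x * U.indicator 1 x := by
  obtain ⟨x, hx⟩ := hU
  refine Finset.sum_pos' (fun y _ => mul_nonneg (G.m_pos y).le
    (Set.indicator_nonneg (by simp) y)) ⟨x, Finset.mem_univ x, ?_⟩
  simpa [hx] using G.m_pos x

theorem two_mul_sum_m_mul_indicator_le (hU : G.vol U ≤ G.vol Set.univ / 2) :
    2 * ∑ x, G.m x * U.indicator 1 x ≤ ∑ x, G.m x := by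
  rw [vol_eq_ofReal, vol_eq_ofReal, ← ENNReal.ofReal_ofNat 2, ← ENNReal.ofReal_div_of_pos two_pos,
    ENNReal.ofReal_le_ofReal_iff (div_nonneg (Finset.sum_nonneg fun x _ => mul_nonneg (G.m_pos x).le
      (Set.indicator_nonneg (by simp) x)) zero_le_two)] at hU
  simp only [Set.indicator_univ, Pi.one_apply, mul_one] at hU
  linarith

theorem half_le_variance_indicator [Nonempty V] (hvol : G.vol U ≤ G.vol Set.univ / 2) :
    (∑ x, G.m x * U.indicator 1 x) / 2
      ≤ ∑ x, G.m x * (U.indicator 1 x - G.mean (U.indicator 1)) ^ 2 := by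
  have hb : 0 < ∑ x, G.m x := sum_m_pos
  have hle := two_mul_sum_m_mul_indicator_le hvol
  have ha : 0 ≤ ∑ x, G.m x * U.indicator 1 x := Finset.sum_nonneg fun x _ =>
    mul_nonneg (G.m_pos x).le (Set.indicator_nonneg (by simp) x)
  have hvar : ∑ x, G.m x * (U.indicator 1 x - G.mean (U.indicator 1)) ^ 2
      = (∑ x, G.m x * U.indicator 1 x) * (1 - G.mean (U.indicator 1)) := by
    have hzero := sum_m_mul_sub_mean (G := G) (U.indicator 1)
    rw [← sub_zero (_ * _), ← mul_zero (G.mean (U.indicator 1)), ← hzero, Finset.sum_mul,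
      Finset.mul_sum, ← Finset.sum_sub_distrib]
    refine Finset.sum_congr rfl fun x _ => ?_
    by_cases hx : x ∈ U <;> simp only [hx, Set.indicator_of_mem, Set.indicator_of_notMem,
      not_false_eq_true, Pi.one_apply] <;> ring
  have hmean : G.mean (U.indicator 1) ≤ 1 / 2 := by
    rw [mean, div_le_iff₀ hb]
    linarith
  rw [hvar, div_eq_mul_one_div]
  exact mul_le_mul_of_nonneg_left (by linarith) ha

end Cheeger

section Buser

variable {V : Type*} {G : MWG V} {U : Set V}

theorem nontrivial_of_vol_le (hU : U.Nonempty) (hvol : G.vol U ≤ G.vol Set.univ / 2) :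
    Nontrivial V := by
  by_contra hV
  rw [not_nontrivial_iff_subsingleton] at hV
  have := Fintype.ofFinite V
  have hle := two_mul_sum_m_mul_indicator_le hvol
  have hpos := sum_m_mul_indicator_pos (G := G) hU
  rw [Subsingleton.eq_univ_of_nonempty hU] at hle hpos
  simp only [Set.indicator_univ, Pi.one_apply, mul_one] at hle hpos
  linarith

variable [TopologicalSpace V] [DiscreteTopology V] {h : G.degMax < ∞} {s T : ℝ}

namespace HeatGradientBounds

theorem one_sub_exp_mul_le [Fintype V] [Nonempty V] (hG : HeatGradientBounds h s T)
    {q₀ lam t : ℝ} (hq₀ : 0 < q₀) (hq : ∀ x y, 0 < G.w x y → q₀ ≤ G.q x y)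
    (hlam₀ : 0 ≤ lam) (hlam : ENNReal.ofReal lam ≤ G.lambda1) (ht : t ∈ Set.Icc 0 T)
    (hvol : G.vol U ≤ G.vol Set.univ / 2) :
    (1 - Real.exp (-(lam * t))) * ((∑ x, G.m x * U.indicator 1 x) / 2)
      ≤ 2 * √t * (√(2 / q₀) * ∑ x, G.m x * G.Γ (U.indicator 1) (U.indicator 1) x) := by
  let f : V →ᵇ ℝ := .mkOfCompact ⟨U.indicator 1, continuous_of_discreteTopology⟩
  have hf01 (x : V) : f x = 0 ∨ f x = 1 := by
    change U.indicator 1 x = 0 ∨ U.indicator 1 x = 1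
    by_cases hx : x ∈ U <;> simp [hx]
  have hexp : 0 ≤ 1 - Real.exp (-(lam * t)) :=
    sub_nonneg.2 (Real.exp_le_one_iff.2 (neg_nonpos.2 (mul_nonneg hlam₀ ht.1)))
  calc (1 - Real.exp (-(lam * t))) * ((∑ x, G.m x * U.indicator 1 x) / 2)
      ≤ (1 - Real.exp (-(lam * t))) * ∑ x, G.m x * (f x - G.mean f) ^ 2 :=
        mul_le_mul_of_nonneg_left (half_le_variance_indicator hvol) hexp
    _ ≤ ∑ x, G.m x * (f x * (f x - heatCLM h t f x)) := one_sub_exp_mul_variance_le h hlam ht.1 f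
    _ ≤ 2 * √t * ∑ x, G.m x * √(G.Γ f f x) :=
        hG.sum_m_mul_sub_heatCLM_le (fun x => by rcases hf01 x with hx | hx <;> simp [hx]) ht
    _ ≤ 2 * √t * (√(2 / q₀) * ∑ x, G.m x * G.Γ f f x) := by
        gcongr
        rw [Finset.mul_sum]
        refine Finset.sum_le_sum fun x _ => ?_
        rw [mul_left_comm]
        refine mul_le_mul_of_nonneg_left (sqrt_Γ_le hq₀ (hq x) fun y => ?_) (G.m_pos x).le
        rcases hf01 x with hx | hx <;> rcases hf01 y with hy | hy <;> simp [hx, hy]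

theorem le_mul_sq_div [Fintype V] [Nonempty V] (hG : HeatGradientBounds h s T) (hs0 : 0 < s)
    (hs1 : s < 1) (hT : 0 < T) {q₀ lam : ℝ} (hq₀ : 0 < q₀) (hq : ∀ x y, 0 < G.w x y → q₀ ≤ G.q x y)
    (hlamT : -Real.log s / T ≤ lam) (hlam : ENNReal.ofReal lam ≤ G.lambda1) (hU : U.Nonempty)
    (hvol : G.vol U ≤ G.vol Set.univ / 2) :
    lam ≤ 32 * -Real.log s / (q₀ * (1 - s) ^ 2) *
      ((∑ x, G.m x * G.Γ (U.indicator 1) (U.indicator 1) x) /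
        ∑ x, G.m x * U.indicator 1 x) ^ 2 := by
  set a := ∑ x, G.m x * U.indicator 1 x with ha_def
  set δ := ∑ x, G.m x * G.Γ (U.indicator 1) (U.indicator 1) x with hδ_def
  have ha : 0 < a := sum_m_mul_indicator_pos hU
  have hlog : 0 < -Real.log s := neg_pos.2 (Real.log_neg hs0 hs1)
  have hlam₀ : 0 < lam := (div_pos hlog hT).trans_le hlamT
  set t := -Real.log s / lam with ht_def
  have ht₀ : 0 ≤ t := (div_pos hlog hlam₀).le
  have htT : t ≤ T := by rwa [div_le_comm₀ hlam₀ hT]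
  have hexp : Real.exp (-(lam * t)) = s := by
    rw [ht_def, mul_div_cancel₀ _ hlam₀.ne', neg_neg, Real.exp_log hs0]
  have hlin := hG.one_sub_exp_mul_le hq₀ hq hlam₀.le hlam ⟨ht₀, htT⟩ hvol
  rw [hexp, ← ha_def, ← hδ_def] at hlin
  have : 0 < 1 - s := sub_pos.2 hs1
  have hsq : ((1 - s) * (a / 2)) ^ 2 ≤ 4 * t * (2 / q₀) * δ ^ 2 := by
    refine (pow_le_pow_left₀ (by positivity) hlin 2).trans_eq ?_
    rw [mul_pow, mul_pow, mul_pow, Real.sq_sqrt ht₀, Real.sq_sqrt (by positivity)]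
    ring
  have hprod : 4 * t * (2 / q₀) * δ ^ 2 * (4 * q₀ * lam) = 32 * -Real.log s * δ ^ 2 := by
    rw [ht_def]
    field_simp
    ring
  rw [div_pow, div_mul_div_comm, le_div_iff₀ (by positivity), ← hprod]
  linarith [mul_le_mul_of_nonneg_right hsq (by positivity : 0 ≤ 4 * q₀ * lam)]

theorem lambda1_le_mul_sq_div [Finite V] (hG : HeatGradientBounds h s T) (hs0 : 0 < s)
    (hs1 : s < 1) (hT : 0 < T) (hU : U.Nonempty) (hvol : G.vol U ≤ G.vol Set.univ / 2) :
    G.lambda1 ≤ ENNReal.ofReal (32 * -Real.log s / (G.qInf.toReal * (1 - s) ^ 2)) *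
      (G.boundary U / G.vol U) ^ 2 := by
  have := Fintype.ofFinite V
  have := nontrivial_of_vol_le hU hvol
  have hq₀ : 0 < G.qInf.toReal := ENNReal.toReal_pos G.qInf_pos.ne' qInf_ne_top
  have hq (x y : V) (hxy : 0 < G.w x y) : G.qInf.toReal ≤ G.q x y :=
    ENNReal.toReal_le_of_le_ofReal (G.q_nonneg x y) (qInf_le hxy)
  have hlog : 0 < -Real.log s := neg_pos.2 (Real.log_neg hs0 hs1)
  rw [vol_eq_ofReal, boundary_eq_ofReal, ← ENNReal.ofReal_div_of_pos (sum_m_mul_indicator_pos hU),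
    ← ENNReal.ofReal_pow (div_nonneg (Finset.sum_nonneg fun x _ => mul_nonneg (G.m_pos x).le
      (G.Γ_self_nonneg _ x)) (sum_m_mul_indicator_pos hU).le),
    ← ENNReal.ofReal_mul (by positivity)]
  refine ENNReal.le_of_forall_nnreal_lt fun r hr => ?_
  rw [← ENNReal.ofReal_coe_nnreal] at hr ⊢
  refine ENNReal.ofReal_le_ofReal ((le_max_left (r : ℝ) (-Real.log s / T)).trans ?_)
  refine hG.le_mul_sq_div hs0 hs1 hT hq₀ hq (le_max_right _ _) ?_ hU hvol
  rw [ENNReal.ofReal_max]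
  exact max_le hr.le (hG.ofReal_neg_log_div_le_lambda1 hs0 hT)

end HeatGradientBounds

end Buser

theorem lambda1_le_mul_cheeger_sq {V : Type*} {G : MWG V} {c : ℝ} (hc : 0 < c)
    (h : ∀ U : Set V, U.Nonempty → G.vol U ≤ G.vol Set.univ / 2 →
      G.lambda1 ≤ ENNReal.ofReal c * (G.boundary U / G.vol U) ^ 2) :
    G.lambda1 ≤ ENNReal.ofReal c * G.cheeger ^ 2 := by
  have hroot (X : ℝ≥0∞) : G.lambda1 ≤ ENNReal.ofReal c * X ^ 2 ↔
      (G.lambda1 / ENNReal.ofReal c) ^ (2⁻¹ : ℝ) ≤ X := by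
    rw [ENNReal.rpow_inv_le_iff two_pos, ENNReal.rpow_ofNat,
      ENNReal.div_le_iff' (ENNReal.ofReal_pos.2 hc).ne' ENNReal.ofReal_ne_top]
  exact (hroot _).2 (le_iInf₂ fun U hU => (hroot _).1 (h U hU.1 hU.2.2))

end MWG

end BuserInequality

theorem mainTheorem4 (K T : ℝ) (hK : 0 < K) (hT : 0 < T) (q₀ : ℝ≥0∞) :
    ∃ c : ℝ, 0 < c ∧
      ∀ (V : Type*) [Countable V] (G : MWG V) (ρ : V → ℝ),
        G.qInf = q₀ → G.degMax < ∞ → G.CD ρ ∞ →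
        G.kato T (fun x => -min 0 (ρ x - K)) <
          ENNReal.ofReal (1 / 4 * (1 - Real.exp (-K * T / 2))) →
        G.lambda1 ≤ ENNReal.ofReal c * G.cheeger ^ 2 := by
  set s := Real.exp (-K * T / 2)
  have hs1 : s < 1 := Real.exp_lt_one_iff.2 (by nlinarith [mul_pos hK hT])
  set c := 32 * -Real.log s / (q₀.toReal * (1 - s) ^ 2)
  have hc : 0 ≤ c := div_nonneg (by linarith [Real.log_neg (Real.exp_pos _) hs1]) (by positivity)
  -- The summand `1` keeps the constant positive when `q₀` is `0` or `∞`, where `c = x / 0 = 0`.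
  refine ⟨c + 1, by linarith, fun V _ G ρ hq hdeg hCD hkato => ?_⟩
  let _ : TopologicalSpace V := ⊥
  have _ : DiscreteTopology V := ⟨rfl⟩
  have hG := MWG.heatGradientBounds_of_kato hdeg hK.le hT.le hCD hkato
  have : Finite V := hG.finite (Real.exp_pos _).le hs1 hT.le
  refine MWG.lambda1_le_mul_cheeger_sq (by linarith) fun U hU hvol => ?_
  subst hq
  refine (hG.lambda1_le_mul_sq_div (Real.exp_pos _) hs1 hT hU hvol).trans ?_
  gcongr
  linarith
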